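/- Let $\mathbf k$ be an algebraically closed field and let $s>2$ be an integer. Free algebras $\mathbf k\langle z_1,\dots,z_n\rangle$ are graded by $\deg z_i=1$, and the subscript $d$ denotes the component of degree $d$. An $s$-homogeneous algebra is a graded algebra $\Lambda=\mathbf k\langle z_1,\dots,z_n\rangle/(W)$, where $W$ is a subspace of $\mathbf k\langle z_1,\dots,z_n\rangle_s$. Put $V=\mathbf k\langle z_1,\dots,z_n\rangle_1$ and identify $\mathbf k\langle z_1,\dots,z_n\rangle_d$ with $V^{\otimes d}$. The algebra $\Lambda$ satisfies Berger's extra condition if $$\big(W\otimes V^{\otimes(s-1)}\big)\cap\Big(V\otimes\sum_{i=0}^{s-2}V^{\otimes i}\otimes W\otimes V^{\otimes(s-2-i)}\Big)=\big((W\otimes V)\cap(V\otimes W)\big)\otimes V^{\otimes(s-2)}$$ as subspaces of $V^{\otimes(2s-1)}$. The algebra $\Lambda$ is $s$-Koszul if for every $i\ge 0$ the graded space $\mathrm{Ext}^i_\Lambda(\mathbf k,\mathbf k)$ (for graded right modules, $\mathbf k=\Lambda/\Lambda_{>0}$) is concentrated in degree $-\chi_s(i)$, where $\chi_s(i)=\frac{is}{2}$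 for even $i$ and $\chi_s(i)=\frac{(i-1)s}{2}+1$ for odd $i$. Proposition. Let $\Lambda$ be an $s$-homogeneous algebra that is isomorphic, as a graded algebra, to $\mathbf k\langle x_1,\dots,x_m,y_1\rangle/(y_1f,fy_1)$ for some $m\ge 0$ and some $f\in\mathbf k\langle x_1,\dots,x_m,y_1\rangle_{s-1}$ such that $y_1f$ and $fy_1$ are linearly independent. Assume that it is not the case that $s=2t$ and $f=(gy_1)^{t-1}g$ for some integer $t$ and some $g\in\mathbf k\langle x_1,\dots,x_m,y_1\rangle_1$. Then $\Lambda$ does not satisfy the extra condition, and $\Lambda$ is not $s$-Koszul. -/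

import Mathlib

universe u v

namespace HomogeneousAlgebra

/-- The component of degree `d` of the free algebra `k⟨X⟩` (all generators have degree `1`):
the `d`-th power of the linear span `V` of the generators. Under `k⟨X⟩ = T(V)` it is `V^{⊗ d}`,
and for subspaces `U ⊆ V^{⊗ a}`, `U' ⊆ V^{⊗ b}` the product `U * U'` of submodules is
`U ⊗ U' ⊆ V^{⊗ (a + b)}`. -/
noncomputable def freePart (k : Type*) [Field k] (X : Type*) (d : ℕ) :
    Submodule k (FreeAlgebra k X) :=
  Submodule.span k (Set.range (FreeAlgebra.ι k (X := X))) ^ d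

section Presented

variable {k : Type*} [Field k] {X : Type*}

/-- The algebra `k⟨X⟩ / (W)`, where `(W)` is the two-sided ideal generated by `W`. -/
abbrev Alg (W : Submodule k (FreeAlgebra k X)) : Type _ :=
  (TwoSidedIdeal.span (W : Set (FreeAlgebra k X))).ringCon.Quotient

/-- The canonical projection `k⟨X⟩ → k⟨X⟩ / (W)`. -/
def proj (W : Submodule k (FreeAlgebra k X)) : FreeAlgebra k X →ₐ[k] Alg W :=
  RingCon.mkₐ k _

/-- The component of degree `d` of `k⟨X⟩ / (W)`. -/
noncomputable def part (W : Submodule k (FreeAlgebra k X)) (d : ℕ) : Submodule k (Alg W) :=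
  (freePart k X d).map (proj W).toLinearMap

/-- The extra condition for `k⟨X⟩ / (W)`, `W ⊆ V^{⊗ s}`:
`W ⊗ V^{⊗ (s-1)} ∩ V ⊗ ∑_{i=0}^{s-2} V^{⊗ i} ⊗ W ⊗ V^{⊗ (s-2-i)}
  = (W ⊗ V ∩ V ⊗ W) ⊗ V^{⊗ (s-2)}`. -/
def ExtraCondition (s : ℕ) (W : Submodule k (FreeAlgebra k X)) : Prop :=
  (W * freePart k X (s - 1)) ⊓
      (freePart k X 1 *
        ∑ i ∈ Finset.range (s - 1), freePart k X i * W * freePart k X (s - 2 - i)) =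
    ((W * freePart k X 1) ⊓ (freePart k X 1 * W)) * freePart k X (s - 2)

end Presented

section Ext

/-- A `ℤ`-graded right module over a `k`-algebra `Λ` with components `𝒜 d`, `d ≥ 0`. -/
structure GrMod {k : Type u} {Λ : Type v} [Field k] [Ring Λ] [Algebra k Λ] (𝒜 : ℕ → Submodule k Λ) where
  carrier : Type v
  [addCommGroup : AddCommGroup carrier]
  [moduleBase : Module k carrier]
  [moduleRight : Module Λᵐᵒᵖ carrier]
  [isScalarTower : IsScalarTower k Λᵐᵒᵖ carrier]
  deg : ℤ → Submodule k carrier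
  isInternal : DirectSum.IsInternal deg
  smul_mem : ∀ (d : ℕ) (j : ℤ) (a : Λ) (p : carrier),
    a ∈ 𝒜 d → p ∈ deg j → MulOpposite.op a • p ∈ deg (j + d)

attribute [instance] GrMod.addCommGroup GrMod.moduleBase GrMod.moduleRight GrMod.isScalarTower

variable {k : Type u} {Λ : Type v} [Field k] [Ring Λ] [Algebra k Λ] {𝒜 : ℕ → Submodule k Λ}

/-- The homogeneous homomorphisms of degree `e` from a graded right module `M` to the trivial
module `k = Λ / Λ_{>0}`, which is concentrated in degree `0`: the `k`-linear maps `φ : M → k` that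
are `Λ`-linear, i.e. vanish on `M Λ_{>0}`, and that map `M_l` to `k_{l+e}`, i.e. vanish on `M_l`
for `l + e ≠ 0`. -/
def GrMod.homTrivial (M : GrMod 𝒜) (e : ℤ) : Submodule k (M.carrier →ₗ[k] k) where
  carrier := {φ | (∀ (d : ℕ) (a : Λ) (p : M.carrier), 0 < d → a ∈ 𝒜 d →
      φ (MulOpposite.op a • p) = 0) ∧
    ∀ (l : ℤ) (p : M.carrier), p ∈ M.deg l → l + e ≠ 0 → φ p = 0}
  add_mem' := by
    rintro φ ψ ⟨h1, h2⟩ ⟨h3, h4⟩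
    refine ⟨fun d a p hd ha => ?_, fun l p hp hl => ?_⟩
    · rw [LinearMap.add_apply, h1 d a p hd ha, h3 d a p hd ha, add_zero]
    · rw [LinearMap.add_apply, h2 l p hp hl, h4 l p hp hl, add_zero]
  zero_mem' := ⟨fun _ _ _ _ _ => rfl, fun _ _ _ _ => rfl⟩
  smul_mem' := by
    rintro c φ ⟨h1, h2⟩
    refine ⟨fun d a p hd ha => ?_, fun l p hp hl => ?_⟩
    · rw [LinearMap.smul_apply, h1 d a p hd ha, smul_zero]
    · rw [LinearMap.smul_apply, h2 l p hp hl, smul_zero]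

/-- A resolution `⋯ → P 1 → P 0 → k → 0` of the trivial module by graded projective right modules
and homogeneous maps of degree `0`. -/
structure GrRes {k : Type u} {Λ : Type v} [Field k] [Ring Λ] [Algebra k Λ] (𝒜 : ℕ → Submodule k Λ) where
  P : ℕ → GrMod 𝒜
  projective : ∀ i, Module.Projective Λᵐᵒᵖ (P i).carrier
  d : ∀ i, (P (i + 1)).carrier →ₗ[Λᵐᵒᵖ] (P i).carrier
  d_mem : ∀ (i : ℕ) (j : ℤ) (p : (P (i + 1)).carrier), p ∈ (P (i + 1)).deg j → d i p ∈ (P i).deg j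
  aug : (P 0).carrier →ₗ[k] k
  aug_mem : aug ∈ (P 0).homTrivial 0
  aug_surjective : Function.Surjective aug
  exact_aug : Function.Exact (d 0) aug
  exact_d : ∀ i, Function.Exact (d (i + 1)) (d i)

/-- The cocycles of the complex `Hom_Λ(P, k)` in cohomological degree `i` and internal
degree `e`. -/
def GrRes.cocycles (R : GrRes 𝒜) (i : ℕ) (e : ℤ) : Submodule k ((R.P i).carrier →ₗ[k] k) :=
  (R.P i).homTrivial e ⊓ LinearMap.ker (((R.d i).restrictScalars k).lcomp k k)

/-- The coboundaries of the complex `Hom_Λ(P, k)` in cohomological degree `i` and internal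
degree `e`. -/
def GrRes.coboundaries (R : GrRes 𝒜) :
    (i : ℕ) → (e : ℤ) → Submodule k ((R.P i).carrier →ₗ[k] k)
  | 0, _ => ⊥
  | i + 1, e => ((R.P i).homTrivial e).map (((R.d i).restrictScalars k).lcomp k k)

/-- The component of internal degree `e` of `Ext^i_Λ(k, k)`, computed with the resolution `R` as
cocycles modulo coboundaries, is zero. -/
def GrRes.ExtPartIsZero (R : GrRes 𝒜) (i : ℕ) (e : ℤ) : Prop :=
  R.cocycles i e ≤ R.coboundaries i e

end Ext

/-- `χ_s(i) = is/2` for even `i` and `(i-1)s/2 + 1` for odd `i`. -/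
def chi (s i : ℕ) : ℕ := if Even i then i / 2 * s else (i - 1) / 2 * s + 1

/-- `k⟨X⟩ / (W)` is `s`-Koszul: every `Ext^i(k, k)` is concentrated in degree `-χ_s(i)`.
The graded spaces `Ext^i(k, k)` do not depend on the resolution up to isomorphism. -/
def IsSKoszul {k X : Type*} [Field k] (s : ℕ) (W : Submodule k (FreeAlgebra k X)) : Prop :=
  ∀ (R : GrRes (part W)) (i : ℕ) (e : ℤ), e ≠ -(chi s i : ℤ) → R.ExtPartIsZero i e

end HomogeneousAlgebra

namespace HomogeneousAlgebra

/-! ### Left derivatives and right independence in the free algebra. -/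

section FreeAlgebra

variable {k : Type*} [Field k] {X : Type*}

/-! Both failures come from the overlap `(f y) f = f (y f)`, a relation between the two relators
that linear relations between them do not explain.

The core is `eq_zero_of_linear_syzygy`: if `y f a + f y b = c y f + d f y` with `b`, `c`, `d`
linear, then `b = 0` outside the excluded case. Write `∂ᵢ` for removal of a leading letter `i`. For
letters `i ≠ y` this gives `∂ᵢf · y b = Cᵢ y f + Dᵢ f y` with scalars `Cᵢ`, `Dᵢ`. Suppose `b ≠ 0`.
If all these `∂ᵢf` vanish, then `f` is a multiple of a power of `y`, so `y f = f y`. If some `∂ᵢf`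
is nonzero and all `Dᵢ` vanish, peeling `y b` off the right end of `f` gives `f = e (b y)^{t-1} b`,
and a `t`-th root of `e` puts `f` in the excluded form. If some `Dᵢ` is nonzero, then `b` is
proportional to `y`, and peeling `y` off the right forces every `∂ᵢf` to vanish.

Extra condition (`not_extraCondition`): `f y f` lies in the left-hand intersection, while the syzygy
lemma puts the right-hand side inside `y f · k⟨X⟩`. This contradicts the right independence of `y f`
and `f y` (`eq_zero_of_mul_add_mul_eq_zero`).

Koszulity (`not_isSKoszul`): a resolution begins `Λ(-s)² → V ⊗ Λ → Λ`. If `Ext³` lived only in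
degree `-(s+1)`, the kernel of the first map would be generated in degree `s+1`
(`GrRes.mem_span_of_extPartIsZero`). There the coefficient at `f y` is zero by the syzygy lemma, but
`(0, f)` is in the kernel and `f ≠ 0` in `Λ`.

A graded isomorphism is induced by a linear change of generators (`exists_algEquiv_of_algEquiv`), so
the syzygy lemma need only be proved when `y` is a letter. -/

theorem freePart_zero : freePart k X 0 = 1 := pow_zero _

theorem freePart_add (a b : ℕ) : freePart k X (a + b) = freePart k X a * freePart k X b :=
  pow_add _ _ _

theorem freePart_one : freePart k X 1 = Submodule.span k (Set.range (FreeAlgebra.ι k)) :=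
  pow_one _

theorem mem_freePart_zero {x : FreeAlgebra k X} :
    x ∈ freePart k X 0 ↔ ∃ c : k, algebraMap k _ c = x := by
  rw [freePart_zero, Submodule.mem_one]

theorem ι_mem_freePart (i : X) : FreeAlgebra.ι k i ∈ freePart k X 1 := by
  rw [freePart_one]
  exact Submodule.subset_span ⟨i, rfl⟩

theorem mul_mem_freePart {a b c : ℕ} {x z : FreeAlgebra k X} (hx : x ∈ freePart k X a)
    (hz : z ∈ freePart k X b) (h : a + b = c) : x * z ∈ freePart k X c := by
  rw [← h, freePart_add]
  exact Submodule.mul_mem_mul hx hz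

theorem freePart_succ_induction {d : ℕ} {p : FreeAlgebra k X → Prop} {x : FreeAlgebra k X}
    (hx : x ∈ freePart k X (d + 1))
    (mul : ∀ (i : X) (w : FreeAlgebra k X), w ∈ freePart k X d → p (FreeAlgebra.ι k i * w))
    (zero : p 0) (add : ∀ a b, p a → p b → p (a + b)) : p x := by
  rw [add_comm, freePart_add, freePart_one] at hx
  refine Submodule.mul_induction_on hx (fun v hv w hw => ?_) add
  induction hv using Submodule.span_induction generalizing w with
  | mem v hv => obtain ⟨i, rfl⟩ := hv; exact mul i w hw
  | zero => rwa [zero_mul]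
  | add v v' _ _ h h' => rw [add_mul]; exact add _ _ (h w hw) (h' w hw)
  | smul c v _ h => rw [smul_mul_assoc, ← mul_smul_comm]; exact h _ (Submodule.smul_mem _ _ hw)

/-- An algebra homomorphism that maps the generators into `U` maps the component of degree `d`
into `U ^ d`. -/
theorem map_mem_of_freePart {A : Type*} [Ring A] [Algebra k A] (φ : FreeAlgebra k X →ₐ[k] A)
    (U : Submodule k A) (h : ∀ i, φ (FreeAlgebra.ι k i) ∈ U) {d : ℕ}
    {x : FreeAlgebra k X} (hx : x ∈ freePart k X d) : φ x ∈ U ^ d := by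
  have h1 : (freePart k X 1).map φ.toLinearMap ≤ U := by
    rw [freePart_one, Submodule.map_span_le]
    rintro _ ⟨i, rfl⟩
    exact h i
  have h2 : (freePart k X d).map φ.toLinearMap ≤ U ^ d := by
    have : freePart k X d = freePart k X 1 ^ d := by rw [freePart_one]; rfl
    rw [this, Submodule.map_pow]
    exact pow_le_pow_left' h1 d
  exact h2 (Submodule.mem_map_of_mem hx)

theorem map_freePart_mem {Y : Type*} (φ : FreeAlgebra k X →ₐ[k] FreeAlgebra k Y)
    (h : ∀ i, φ (FreeAlgebra.ι k i) ∈ freePart k Y 1) {d : ℕ}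
    {x : FreeAlgebra k X} (hx : x ∈ freePart k X d) : φ x ∈ freePart k Y d :=
  map_mem_of_freePart φ _ (fun i => freePart_one (k := k) (X := Y) ▸ h i) hx

variable [DecidableEq X]

/-- The algebra homomorphism `a ↦ !![ε a, ∂ᵢ a; 0, a]`, where `∂ᵢ` removes the letter `i` from the
left. -/
noncomputable def leftDerivMatrix (i : X) :
    FreeAlgebra k X →ₐ[k] Matrix (Fin 2) (Fin 2) (FreeAlgebra k X) :=
  FreeAlgebra.lift k fun j => !![0, if i = j then 1 else 0; 0, FreeAlgebra.ι k j]

/-- The left derivative: the linear endomorphism of `k⟨X⟩` that maps a word `i w` to `w` and all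
words that do not begin with `i` to `0`. -/
noncomputable def leftDeriv (i : X) : FreeAlgebra k X →ₗ[k] FreeAlgebra k X where
  toFun a := leftDerivMatrix i a 0 1
  map_add' a b := by simp
  map_smul' c a := by simp

theorem leftDerivMatrix_lower (i : X) (a : FreeAlgebra k X) :
    leftDerivMatrix i a 1 0 = 0 ∧ leftDerivMatrix i a 1 1 = a := by
  induction a using FreeAlgebra.induction with
  | grade0 r => simp [Matrix.algebraMap_matrix_apply]
  | grade1 x => simp [leftDerivMatrix]
  | mul a b ha hb => simp [Matrix.mul_apply, Fin.sum_univ_two, ha, hb]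
  | add a b ha hb => simp [ha, hb]

theorem leftDeriv_ι_mul (i j : X) (w : FreeAlgebra k X) :
    leftDeriv i (FreeAlgebra.ι k j * w) = if i = j then w else 0 := by
  have h := leftDerivMatrix_lower i w
  have h0 : leftDerivMatrix i (FreeAlgebra.ι k j) =
      !![0, if i = j then 1 else 0; 0, FreeAlgebra.ι k j] := by simp [leftDerivMatrix]
  change leftDerivMatrix i (FreeAlgebra.ι k j * w) 0 1 = _
  rw [map_mul, h0]
  simp [Matrix.mul_apply, Fin.sum_univ_two, h.2]

theorem leftDeriv_ι (i j : X) : leftDeriv i (FreeAlgebra.ι k j) = if i = j then 1 else 0 := by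
  simpa using leftDeriv_ι_mul (k := k) i j 1

theorem leftDeriv_mem {d : ℕ} (i : X) {p : FreeAlgebra k X} (hp : p ∈ freePart k X (d + 1)) :
    leftDeriv i p ∈ freePart k X d := by
  refine freePart_succ_induction (p := fun p => leftDeriv i p ∈ freePart k X d) hp
    (fun j w hw => ?_) ?_ fun a b ha hb => ?_
  · rw [leftDeriv_ι_mul]; split_ifs
    exacts [hw, zero_mem _]
  · rw [map_zero]; exact zero_mem _
  · rw [map_add]; exact add_mem ha hb

/-- In general `∂ᵢ(p z) = ε(p) ∂ᵢz + ∂ᵢp · z`, with `ε` the augmentation; positive degree of `p`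
removes the first term. -/
theorem leftDeriv_mul {d : ℕ} (i : X) {p : FreeAlgebra k X} (hp : p ∈ freePart k X (d + 1))
    (z : FreeAlgebra k X) : leftDeriv i (p * z) = leftDeriv i p * z := by
  refine freePart_succ_induction (p := fun p => leftDeriv i (p * z) = leftDeriv i p * z) hp
    (fun j w hw => ?_) ?_ fun a b ha hb => ?_
  · rw [mul_assoc, leftDeriv_ι_mul, leftDeriv_ι_mul]; split_ifs <;> simp
  · simp
  · rw [add_mul, map_add, ha, hb, map_add, add_mul]

theorem sum_ι_mul_leftDeriv [Fintype X] {d : ℕ} {p : FreeAlgebra k X}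
    (hp : p ∈ freePart k X (d + 1)) : ∑ i, FreeAlgebra.ι k i * leftDeriv i p = p := by
  refine freePart_succ_induction (p := fun p => ∑ i, FreeAlgebra.ι k i * leftDeriv i p = p) hp
    (fun j w hw => ?_) ?_ fun a b ha hb => ?_
  · simp [leftDeriv_ι_mul]
  · simp
  · simp only [map_add, mul_add, Finset.sum_add_distrib, ha, hb]

theorem leftDeriv_sum_ι_mul [Fintype X] (q : X → FreeAlgebra k X) (i : X) :
    leftDeriv i (∑ j, FreeAlgebra.ι k j * q j) = q i := by
  simp [leftDeriv_ι_mul]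

theorem leftDeriv_ext [Fintype X] {d : ℕ} {p q : FreeAlgebra k X} (hp : p ∈ freePart k X (d + 1))
    (hq : q ∈ freePart k X (d + 1)) (h : ∀ i, leftDeriv i p = leftDeriv i q) : p = q := by
  rw [← sum_ι_mul_leftDeriv hp, ← sum_ι_mul_leftDeriv hq]
  simp [h]

theorem eq_ι_mul_leftDeriv [Fintype X] {d : ℕ} {p : FreeAlgebra k X}
    (hp : p ∈ freePart k X (d + 1)) {j : X} (h : ∀ i, i ≠ j → leftDeriv i p = 0) :
    p = FreeAlgebra.ι k j * leftDeriv j p := by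
  conv_lhs => rw [← sum_ι_mul_leftDeriv hp]
  exact Finset.sum_eq_single j (fun i _ hi => by rw [h i hi, mul_zero]) (by simp)

/-- Homogeneous elements of the same degree that are linearly independent over `k` are right
linearly independent; the version for two elements. -/
theorem add_smul_eq_zero_of_mul_add_mul_eq_zero [Fintype X] {d : ℕ} {a b p q : FreeAlgebra k X}
    (ha : a ∈ freePart k X d) (hb : b ∈ freePart k X d) (h : a * p + b * q = 0)
    (l : FreeAlgebra k X →ₗ[k] k) (hl : l p = 1) : a + l q • b = 0 := by
  induction d generalizing a b with
  | zero =>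
    obtain ⟨α, rfl⟩ := mem_freePart_zero.1 ha
    obtain ⟨β, rfl⟩ := mem_freePart_zero.1 hb
    have h' := congrArg l h
    rw [← Algebra.smul_def, ← Algebra.smul_def, map_add, map_smul, map_smul, hl, map_zero,
      smul_eq_mul, smul_eq_mul, mul_one] at h'
    rw [Algebra.smul_def, ← map_mul, ← map_add, mul_comm, h', map_zero]
  | succ d ih =>
    -- Differentiation only shortens the left factors `a`, `b`. Since `p` and `q` never change, the
    -- same scalar `l q` serves for every derivative.
    refine leftDeriv_ext (add_mem ha (Submodule.smul_mem _ _ hb)) (zero_mem _) fun i => ?_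
    rw [map_add, map_smul, map_zero]
    refine ih (leftDeriv_mem i ha) (leftDeriv_mem i hb) ?_
    rw [← leftDeriv_mul i ha, ← leftDeriv_mul i hb, ← map_add, h, map_zero]

/-- `a p + b q = 0` forces `p = q = 0` when `a`, `b` are homogeneous of the same degree and
linearly independent. -/
theorem eq_zero_of_mul_add_mul_eq_zero [Fintype X] {d : ℕ} {a b p q : FreeAlgebra k X}
    (ha : a ∈ freePart k X d) (hb : b ∈ freePart k X d)
    (hab : ∀ α β : k, α • a + β • b = 0 → α = 0 ∧ β = 0)
    (h : a * p + b * q = 0) : p = 0 ∧ q = 0 := by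
  constructor
  · by_contra hp
    obtain ⟨l, hl⟩ := Module.Projective.exists_dual_eq_one k hp
    have := add_smul_eq_zero_of_mul_add_mul_eq_zero ha hb h l hl
    exact one_ne_zero (hab 1 (l q) (by rwa [one_smul])).1
  · by_contra hq
    obtain ⟨l, hl⟩ := Module.Projective.exists_dual_eq_one k hq
    have := add_smul_eq_zero_of_mul_add_mul_eq_zero hb ha (by rwa [add_comm]) l hl
    exact one_ne_zero (hab (l p) 1 (by rwa [one_smul, add_comm])).2

end FreeAlgebra

/-! ### Word equations and the linear syzygies of `y f` and `f y`. -/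

section Equations

variable {k : Type*} [Field k] {X : Type*} [DecidableEq X]

theorem leftDeriv_eq_zero_of_mem_freePart_zero (i : X) {p : FreeAlgebra k X}
    (hp : p ∈ freePart k X 0) : leftDeriv i p = 0 := by
  obtain ⟨c, rfl⟩ := mem_freePart_zero.1 hp
  change leftDerivMatrix i (algebraMap k _ c) 0 1 = 0
  simp [Matrix.algebraMap_matrix_apply]

theorem leftDeriv_ι_of_ne {i j : X} (h : i ≠ j) (w : FreeAlgebra k X) :
    leftDeriv i (FreeAlgebra.ι k j * w) = 0 := by
  rw [leftDeriv_ι_mul, if_neg h]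

theorem leftDeriv_ι_mul_self (i : X) (w : FreeAlgebra k X) :
    leftDeriv i (FreeAlgebra.ι k i * w) = w := by
  rw [leftDeriv_ι_mul, if_pos rfl]

theorem leftDeriv_eq_zero_of_eq_ι_mul {d : ℕ} {p z w : FreeAlgebra k X} {i j : X}
    (hp : p ∈ freePart k X (d + 1)) (hz : z ≠ 0) (h : p * z = FreeAlgebra.ι k j * w)
    (hij : i ≠ j) : leftDeriv i p = 0 := by
  have h' := congrArg (leftDeriv i) h
  rw [leftDeriv_mul i hp, leftDeriv_ι_of_ne hij] at h'
  exact (mul_eq_zero.1 h').resolve_right hz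

theorem exists_eq_ι_mul [Fintype X] {d : ℕ} {p z w : FreeAlgebra k X} {j : X}
    (hp : p ∈ freePart k X (d + 1)) (hz : z ≠ 0) (h : p * z = FreeAlgebra.ι k j * w) :
    ∃ q ∈ freePart k X d, p = FreeAlgebra.ι k j * q :=
  ⟨leftDeriv j p, leftDeriv_mem j hp,
    eq_ι_mul_leftDeriv hp fun _ hi => leftDeriv_eq_zero_of_eq_ι_mul hp hz h hi⟩

/-- If `C = 0`, cancel one `y` on the right. Otherwise `y f = v y` for a homogeneous `v` of positive
degree, and removing the leading `y` exhibits `f` as `∂v · y`. -/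
theorem exists_eq_mul_ι {N : ℕ} {f : FreeAlgebra k X} {i j : X}
    (hf : f ∈ freePart k X (N + 1)) (C D : k) (hne : leftDeriv i f ≠ 0)
    (h : leftDeriv i f * FreeAlgebra.ι k j * FreeAlgebra.ι k j =
      C • (FreeAlgebra.ι k j * f) + D • (f * FreeAlgebra.ι k j)) :
    ∃ g ∈ freePart k X N, f = g * FreeAlgebra.ι k j := by
  have hy : FreeAlgebra.ι k j ≠ 0 := FreeAlgebra.ι_ne_zero j
  have hfi := leftDeriv_mem i hf
  by_cases hC : C = 0
  · have hD : D ≠ 0 := by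
      intro hD
      simp [hC, hD, hne, hy] at h
    refine ⟨D⁻¹ • leftDeriv i f, Submodule.smul_mem _ _ hfi, mul_right_cancel₀ hy ?_⟩
    rw [smul_mul_assoc, smul_mul_assoc, h, hC, zero_smul, zero_add, inv_smul_smul₀ hD]
  · have hv : C⁻¹ • (leftDeriv i f * FreeAlgebra.ι k j - D • f) ∈ freePart k X (N + 1) :=
      Submodule.smul_mem _ _ (sub_mem (mul_mem_freePart hfi (ι_mem_freePart j) rfl)
        (Submodule.smul_mem _ _ hf))
    refine ⟨_, leftDeriv_mem j hv, ?_⟩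
    rw [← leftDeriv_mul j hv, smul_mul_assoc, sub_mul, h, smul_mul_assoc, add_sub_cancel_right,
      inv_smul_smul₀ hC, leftDeriv_ι_mul_self]

/-- A nonzero `∂ᵢf` makes `f` end in `y`. The factor left after cancelling that `y` satisfies the
same equations with the same scalars, and descent ends at a multiple of `y`, whose other derivatives
vanish. -/
theorem leftDeriv_eq_zero_of_mul_sq {N : ℕ} {f : FreeAlgebra k X} {j : X}
    (hf : f ∈ freePart k X (N + 1)) (C D : X → k)
    (h : ∀ i, i ≠ j → leftDeriv i f * FreeAlgebra.ι k j * FreeAlgebra.ι k j =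
      C i • (FreeAlgebra.ι k j * f) + D i • (f * FreeAlgebra.ι k j)) :
    ∀ i, i ≠ j → leftDeriv i f = 0 := by
  have hy : FreeAlgebra.ι k j ≠ 0 := FreeAlgebra.ι_ne_zero j
  intro i hi
  by_contra hne
  induction N generalizing f with
  | zero =>
    obtain ⟨g, hg, rfl⟩ := exists_eq_mul_ι hf _ _ hne (h i hi)
    obtain ⟨c, rfl⟩ := mem_freePart_zero.1 hg
    exact hne (by rw [← Algebra.smul_def, map_smul, leftDeriv_ι, if_neg hi, smul_zero])
  | succ N ih =>
    obtain ⟨g, hg, rfl⟩ := exists_eq_mul_ι hf _ _ hne (h i hi)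
    refine ih hg (fun i hi => mul_right_cancel₀ hy ?_) fun h0 => hne ?_
    · rw [← leftDeriv_mul i hg, h i hi]
      simp only [smul_mul_assoc, mul_assoc, add_mul]
    · rw [leftDeriv_mul i hg, h0, zero_mul]

/-- If `∂ᵢ f · y b = Cᵢ y f` for all letters `i ≠ y`, then `f` is a multiple of `b y b ⋯ y b`. -/
theorem eq_smul_pow_mul_of_leftDeriv_mul [Fintype X] {f b : FreeAlgebra k X} {j : X} (hb0 : b ≠ 0)
    (C : X → k) (N : ℕ) (hf : f ∈ freePart k X N)
    (h : ∀ i, i ≠ j → leftDeriv i f * FreeAlgebra.ι k j * b = C i • (FreeAlgebra.ι k j * f))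
    (hne : ∃ i, i ≠ j ∧ leftDeriv i f ≠ 0) :
    ∃ (t : ℕ) (c : k), N = 2 * t + 1 ∧ f = c • ((b * FreeAlgebra.ι k j) ^ t * b) := by
  have hy : FreeAlgebra.ι k j ≠ 0 := FreeAlgebra.ι_ne_zero j
  set y := FreeAlgebra.ι k j with hyd
  induction N using Nat.strong_induction_on generalizing f with
  | _ N ih =>
    obtain ⟨i, hi, hne⟩ := hne
    have hC : C i ≠ 0 := by
      intro hC
      have := h i hi
      simp [hC, hne, hy, hb0] at this
    match N with
    | 0 => exact absurd (leftDeriv_eq_zero_of_mem_freePart_zero i hf) hne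
    | 1 =>
      obtain ⟨c, hc⟩ := mem_freePart_zero.1 (leftDeriv_mem i hf)
      refine ⟨0, (C i)⁻¹ * c, rfl, mul_left_cancel₀ hy ?_⟩
      have h' := h i hi
      rw [← hc, mul_assoc, ← Algebra.smul_def] at h'
      rw [pow_zero, one_mul, mul_smul_comm, mul_smul, h', inv_smul_smul₀ hC]
    | M + 2 =>
      have hfi := leftDeriv_mem i hf
      -- The right-hand side begins with `y`, so `∂ᵢf = y r`. Cancelling `y` gives `f = Cᵢ⁻¹ r y b`,
      -- and the shorter factor satisfies the same equations.
      obtain ⟨r, hr, hfr⟩ := exists_eq_ι_mul (j := j) (z := y * b) (w := C i • f) hfi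
        (mul_ne_zero hy hb0) (by rw [← mul_assoc, h i hi, mul_smul_comm])
      have hfe : f = ((C i)⁻¹ • r) * y * b := by
        refine mul_left_cancel₀ hy ?_
        rw [smul_mul_assoc, smul_mul_assoc, mul_smul_comm, ← mul_assoc, ← mul_assoc, ← hfr,
          h i hi, inv_smul_smul₀ hC]
      have hr' : (C i)⁻¹ • r ∈ freePart k X M := Submodule.smul_mem _ _ hr
      generalize (C i)⁻¹ • r = r' at hfe hr'
      have hd : ∀ i, i ≠ j → leftDeriv i f = leftDeriv i r' * y * b := by
        intro i hi
        match M with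
        | 0 =>
          obtain ⟨c, rfl⟩ := mem_freePart_zero.1 hr'
          rw [leftDeriv_eq_zero_of_mem_freePart_zero i hr', hfe, mul_assoc, ← Algebra.smul_def,
            map_smul, leftDeriv_ι_of_ne hi]
          simp
        | M + 1 => rw [hfe, mul_assoc, leftDeriv_mul i hr', mul_assoc]
      obtain ⟨t, c, rfl, hc⟩ := ih M (by omega) hr'
        ⟨i, hi, fun h0 => hne (by rw [hd i hi, h0, zero_mul, zero_mul])⟩ (fun i hi => by
          refine mul_right_cancel₀ (mul_ne_zero hy hb0) ?_
          rw [← mul_assoc, ← hd i hi, ← mul_assoc, h i hi, hfe]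
          simp only [smul_mul_assoc, mul_assoc])
      refine ⟨t + 1, c, by ring, ?_⟩
      rw [hfe, hc, pow_succ]
      simp only [smul_mul_assoc, mul_assoc]

/-- Every term on the right begins with `y`, hence so does `f` in positive degree. Cancelling that
`y` reproduces the equation in degree one less. -/
theorem eq_smul_pow_of_mul_eq [Fintype X] {N : ℕ} {f a b : FreeAlgebra k X} {j : X} (hb0 : b ≠ 0)
    (hf : f ∈ freePart k X N) (γ δ : k)
    (h : f * FreeAlgebra.ι k j * b = γ • (FreeAlgebra.ι k j * (FreeAlgebra.ι k j * f)) +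
      δ • (FreeAlgebra.ι k j * f * FreeAlgebra.ι k j) - FreeAlgebra.ι k j * f * a) :
    ∃ c : k, f = c • FreeAlgebra.ι k j ^ N := by
  have hy : FreeAlgebra.ι k j ≠ 0 := FreeAlgebra.ι_ne_zero j
  set y := FreeAlgebra.ι k j with hyd
  induction N generalizing f with
  | zero =>
    obtain ⟨c, rfl⟩ := mem_freePart_zero.1 hf
    exact ⟨c, by rw [pow_zero, Algebra.algebraMap_eq_smul_one]⟩
  | succ N ih =>
    obtain ⟨g, hg, rfl⟩ := exists_eq_ι_mul (j := j) (z := y * b)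
      (w := γ • (y * f) + δ • (f * y) - f * a) hf (mul_ne_zero hy hb0) (by
        rw [← mul_assoc, h]
        simp only [mul_sub, mul_add, mul_smul_comm, mul_assoc, hyd])
    obtain ⟨c, rfl⟩ := ih hg (mul_left_cancel₀ hy (by
      simp only [← hyd] at h
      simp only [mul_sub, mul_add, mul_smul_comm]
      simp only [mul_assoc] at h ⊢
      exact h))
    exact ⟨c, by rw [mul_smul_comm, pow_succ']⟩

/-- The syzygies `y f a + f y b = c y f + d f y` with linear `a, b, c, d`: except when
`f = (g y)^{t-1} g`, always `b = 0`. -/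
theorem eq_zero_of_linear_syzygy [Fintype X] [IsAlgClosed k] {N : ℕ} {f a b c d : FreeAlgebra k X} {j : X}
    (hf : f ∈ freePart k X (N + 2)) (hb : b ∈ freePart k X 1)
    (hc : c ∈ freePart k X 1) (hd : d ∈ freePart k X 1)
    (hind : ∀ α β : k,
      α • (FreeAlgebra.ι k j * f) + β • (f * FreeAlgebra.ι k j) = 0 → α = 0 ∧ β = 0)
    (hexc : ¬ ∃ (t : ℕ) (g : FreeAlgebra k X), N + 3 = 2 * t ∧ g ∈ freePart k X 1 ∧
      f = (g * FreeAlgebra.ι k j) ^ (t - 1) * g)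
    (h : FreeAlgebra.ι k j * f * a + f * FreeAlgebra.ι k j * b =
      c * (FreeAlgebra.ι k j * f) + d * (f * FreeAlgebra.ι k j)) : b = 0 := by
  by_contra hb0
  have hy : FreeAlgebra.ι k j ≠ 0 := FreeAlgebra.ι_ne_zero j
  set y := FreeAlgebra.ι k j with hyd
  have hyf : f * y ∈ freePart k X (N + 3) := mul_mem_freePart hf (ι_mem_freePart j) rfl
  choose C hC using fun i => mem_freePart_zero.1 (leftDeriv_mem i hc)
  choose D hD using fun i => mem_freePart_zero.1 (leftDeriv_mem i hd)
  -- Removing a letter other than `y` kills `y f a` and turns the linear forms `c`, `d` into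
  -- scalars.
  have hstar : ∀ i, i ≠ j → leftDeriv i f * y * b = C i • (y * f) + D i • (f * y) := by
    intro i hi
    have h' := congrArg (leftDeriv i) h
    rwa [map_add, map_add, mul_assoc y, leftDeriv_ι_of_ne hi, zero_add, mul_assoc f,
      leftDeriv_mul i hf, leftDeriv_mul i hc, leftDeriv_mul i hd, ← hC, ← hD, ← Algebra.smul_def,
      ← Algebra.smul_def, ← mul_assoc] at h'
  by_cases hall : ∀ i, i ≠ j → leftDeriv i f = 0
  · have hz : ∀ i, i ≠ j → C i = 0 ∧ D i = 0 := fun i hi =>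
      hind _ _ (by rw [← hstar i hi, hall i hi, zero_mul, zero_mul])
    have hc' : c = C j • y := by
      rw [eq_ι_mul_leftDeriv (j := j) hc fun i hi => by rw [← hC, (hz i hi).1, map_zero], ← hC,
        ← Algebra.commutes, ← Algebra.smul_def]
    have hd' : d = D j • y := by
      rw [eq_ι_mul_leftDeriv (j := j) hd fun i hi => by rw [← hD, (hz i hi).2, map_zero], ← hD,
        ← Algebra.commutes, ← Algebra.smul_def]
    have hf0 := eq_ι_mul_leftDeriv hf hall
    have hg := leftDeriv_mem j hf
    generalize leftDeriv j f = g at hf0 hg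
    subst hf0
    obtain ⟨e, rfl⟩ := eq_smul_pow_of_mul_eq (a := a) (j := j) hb0 hg (C j) (D j)
      (mul_left_cancel₀ hy (by
        simp only [← hyd]
        rw [hc', hd', ← eq_sub_iff_add_eq'] at h
        simp only [mul_sub, mul_add, mul_smul_comm, smul_mul_assoc, mul_assoc] at h ⊢
        exact h))
    -- Now `f` is a scalar times a power of `y`, so it commutes with `y`.
    have := hind 1 (-1) (by simp [hyd, ← pow_succ', ← pow_succ])
    exact one_ne_zero this.1
  · push Not at hall
    obtain ⟨η, hη, hfη⟩ := hall
    by_cases hD0 : ∀ i, i ≠ j → D i = 0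
    · obtain ⟨t, e, hN, hfe⟩ := eq_smul_pow_mul_of_leftDeriv_mul hb0 C (N + 2) hf
        (fun i hi => by rw [← hyd, hstar i hi, hD0 i hi, zero_smul, add_zero]) ⟨η, hη, hfη⟩
      -- Replacing `b` by `z b` multiplies `(b y)^t b` by `z^(t+1)`, so a root of order `t + 1`
      -- absorbs `e`.
      obtain ⟨z, hz⟩ := IsAlgClosed.exists_pow_nat_eq e (Nat.succ_pos t)
      refine hexc ⟨t + 1, z • b, by omega, Submodule.smul_mem _ _ hb, ?_⟩
      rw [hfe, Nat.add_sub_cancel, smul_mul_assoc, smul_pow, smul_mul_smul_comm, ← pow_succ, hz]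
    · push Not at hD0
      obtain ⟨i, hi, hDi⟩ := hD0
      -- A second derivative kills the term `y f`. What remains has right factors `b` and `y` with
      -- left factors of equal degree, and this forces `y = l(y) b` for a functional `l` with `l(b)
      -- = 1`.
      have h2 : leftDeriv η (leftDeriv i f) * y * b = D i • leftDeriv η f * y := by
        have := congrArg (leftDeriv η) (hstar i hi)
        rwa [map_add, map_smul, map_smul, leftDeriv_ι_of_ne hη, smul_zero, zero_add,
          leftDeriv_mul η hf, mul_assoc, leftDeriv_mul η (leftDeriv_mem i hf), ← mul_assoc,
          ← smul_mul_assoc] at this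
      obtain ⟨l, hl⟩ := Module.Projective.exists_dual_eq_one k hb0
      have h3 := add_smul_eq_zero_of_mul_add_mul_eq_zero (d := N + 1) (p := b) (q := y)
        (mul_mem_freePart (leftDeriv_mem η (leftDeriv_mem i hf)) (ι_mem_freePart j) rfl)
        (neg_mem (Submodule.smul_mem _ (D i) (leftDeriv_mem η hf)))
        (by rw [neg_mul, ← hyd, h2, add_neg_cancel]) l hl
      rw [← hyd, smul_neg, add_neg_eq_zero] at h3
      have h4 : y = l y • b := by
        refine mul_left_cancel₀ (smul_ne_zero hDi hfη) ?_
        rw [← h2, h3, mul_smul_comm, smul_mul_assoc]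
      have hly : l y ≠ 0 := fun h0 => hy (by rw [h4, h0, zero_smul])
      refine hfη (leftDeriv_eq_zero_of_mul_sq hf (fun i => l y * C i) (fun i => l y * D i)
        (fun i hi => ?_) η hη)
      rw [← hyd, mul_smul, mul_smul, ← smul_add, ← hstar i hi, ← mul_smul_comm, ← h4]

end Equations

/-! ### The grading of the quotient, read off from polynomials over it. -/

section Grading

open Polynomial

variable {k : Type*} [Field k] {X : Type*}

/-- For an algebra homomorphism `φ` on `k⟨X⟩`, the homomorphism `x ↦ φ x T ^ d` for `x` homogeneous
of degree `d`. -/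
noncomputable def degreeHom {A : Type*} [Ring A] [Algebra k A] (φ : FreeAlgebra k X →ₐ[k] A) :
    FreeAlgebra k X →ₐ[k] A[X] :=
  FreeAlgebra.lift k fun i => monomial 1 (φ (FreeAlgebra.ι k i))

theorem degreeHom_of_mem {A : Type*} [Ring A] [Algebra k A] (φ : FreeAlgebra k X →ₐ[k] A) {d : ℕ}
    {x : FreeAlgebra k X} (hx : x ∈ freePart k X d) : degreeHom φ x = monomial d (φ x) := by
  induction d generalizing x with
  | zero =>
    obtain ⟨c, rfl⟩ := mem_freePart_zero.1 hx
    rw [AlgHom.commutes, AlgHom.commutes, monomial_zero_left]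
    rfl
  | succ d ih =>
    refine freePart_succ_induction (p := fun x => degreeHom φ x = monomial (d + 1) (φ x)) hx
      (fun i w hw => ?_) (by simp) fun a b ha hb => by rw [map_add, ha, hb, map_add, map_add]
    rw [map_mul, ih hw, degreeHom, FreeAlgebra.lift_ι_apply, monomial_mul_monomial, map_mul φ,
      add_comm]

theorem coeff_zero_degreeHom (a : FreeAlgebra k X) :
    ∃ c : k, (degreeHom (AlgHom.id k (FreeAlgebra k X)) a).coeff 0 = algebraMap k _ c := by
  induction a using FreeAlgebra.induction with
  | grade0 r => exact ⟨r, by rw [AlgHom.commutes]; exact coeff_C_zero⟩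
  | grade1 x => exact ⟨0, by simp [degreeHom, coeff_monomial]⟩
  | mul a b ha hb =>
    obtain ⟨c, hc⟩ := ha
    obtain ⟨c', hc'⟩ := hb
    exact ⟨c * c', by rw [map_mul, mul_coeff_zero, hc, hc', map_mul]⟩
  | add a b ha hb =>
    obtain ⟨c, hc⟩ := ha
    obtain ⟨c', hc'⟩ := hb
    exact ⟨c + c', by rw [map_add, coeff_add, hc, hc', map_add]⟩

variable {W : Submodule k (FreeAlgebra k X)}

theorem proj_eq_zero_iff {x : FreeAlgebra k X} :
    proj W x = 0 ↔ x ∈ TwoSidedIdeal.span (W : Set (FreeAlgebra k X)) :=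
  RingCon.eq _

theorem proj_surjective : Function.Surjective (proj W) := RingCon.mkₐ_surjective _

theorem proj_eq_zero_of_mem {x : FreeAlgebra k X} (hx : x ∈ W) : proj W x = 0 :=
  proj_eq_zero_iff.2 (TwoSidedIdeal.subset_span hx)

theorem proj_mem_part {d : ℕ} {x : FreeAlgebra k X} (hx : x ∈ freePart k X d) :
    proj W x ∈ part W d :=
  Submodule.mem_map_of_mem hx

theorem mem_part_iff {d : ℕ} {a : Alg W} :
    a ∈ part W d ↔ ∃ x ∈ freePart k X d, proj W x = a := Submodule.mem_map

/-- The lowest components of an element of the ideal generated by `W ⊆ k⟨X⟩_s`. -/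
theorem coeff_degreeHom_of_mem_span {s : ℕ} (hW : W ≤ freePart k X s) {x : FreeAlgebra k X}
    (hx : x ∈ TwoSidedIdeal.span (W : Set (FreeAlgebra k X))) :
    (∀ d < s, (degreeHom (AlgHom.id k (FreeAlgebra k X)) x).coeff d = 0) ∧
      (degreeHom (AlgHom.id k (FreeAlgebra k X)) x).coeff s ∈ W := by
  induction hx using TwoSidedIdeal.span_induction with
  | mem x hx =>
    rw [degreeHom_of_mem _ (hW hx)]
    exact ⟨fun d hd => by rw [coeff_monomial, if_neg hd.ne'], by simpa using hx⟩
  | zero => simp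
  | add x y _ _ hx hy =>
    simp only [map_add, coeff_add]
    exact ⟨fun d hd => by rw [hx.1 d hd, hy.1 d hd, add_zero], add_mem hx.2 hy.2⟩
  | neg x _ hx =>
    simp only [map_neg, coeff_neg]
    exact ⟨fun d hd => by rw [hx.1 d hd, neg_zero], neg_mem hx.2⟩
  | left_absorb a x _ hx =>
    simp only [map_mul, coeff_mul]
    refine ⟨fun d hd => Finset.sum_eq_zero fun p hp => ?_, ?_⟩
    · rw [Finset.HasAntidiagonal.mem_antidiagonal] at hp
      rw [hx.1 p.2 (by omega), mul_zero]
    -- Since `x` has no component below degree `s`, only the constant term of `a` contributes in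
    -- degree `s`, and it is a scalar.
    · rw [Finset.sum_eq_single (0, s)]
      · obtain ⟨c, hc⟩ := coeff_zero_degreeHom a
        rw [hc, ← Algebra.smul_def]
        exact Submodule.smul_mem _ _ hx.2
      · rintro ⟨i, j⟩ hp hne
        rw [Finset.HasAntidiagonal.mem_antidiagonal] at hp
        rw [hx.1 j (by grind), mul_zero]
      · simp
  | right_absorb a x _ hx =>
    simp only [map_mul, coeff_mul]
    refine ⟨fun d hd => Finset.sum_eq_zero fun p hp => ?_, ?_⟩
    · rw [Finset.HasAntidiagonal.mem_antidiagonal] at hp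
      rw [hx.1 p.1 (by omega), zero_mul]
    · rw [Finset.sum_eq_single (s, 0)]
      · obtain ⟨c, hc⟩ := coeff_zero_degreeHom a
        rw [hc, ← Algebra.commutes, ← Algebra.smul_def]
        exact Submodule.smul_mem _ _ hx.2
      · rintro ⟨i, j⟩ hp hne
        rw [Finset.HasAntidiagonal.mem_antidiagonal] at hp
        rw [hx.1 i (by grind), zero_mul]
      · simp

theorem mem_of_proj_eq_zero {s : ℕ} (hW : W ≤ freePart k X s) {x : FreeAlgebra k X}
    (hx : x ∈ freePart k X s) (h : proj W x = 0) : x ∈ W := by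
  have := (coeff_degreeHom_of_mem_span hW (proj_eq_zero_iff.1 h)).2
  rwa [degreeHom_of_mem _ hx, coeff_monomial_same] at this

theorem eq_zero_of_proj_eq_zero {s d : ℕ} (hW : W ≤ freePart k X s) (hd : d < s)
    {x : FreeAlgebra k X} (hx : x ∈ freePart k X d) (h : proj W x = 0) : x = 0 := by
  have := (coeff_degreeHom_of_mem_span hW (proj_eq_zero_iff.1 h)).1 d hd
  rwa [degreeHom_of_mem _ hx, coeff_monomial_same] at this

instance part_gradedMonoid : SetLike.GradedMonoid (part W) where
  one_mem := ⟨1, by rw [freePart_zero]; exact Submodule.one_le.1 le_rfl, map_one (proj W)⟩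
  mul_mem := by
    rintro i j _ _ ⟨x, hx, rfl⟩ ⟨z, hz, rfl⟩
    exact ⟨x * z, mul_mem_freePart hx hz rfl, map_mul (proj W) _ _⟩

theorem iSup_part : ⨆ d, part W d = ⊤ := by
  have hmul : (⨆ d, part W d) * (⨆ d, part W d) ≤ ⨆ d, part W d := by
    rw [Submodule.iSup_mul]
    refine iSup_le fun i => ?_
    rw [Submodule.mul_iSup]
    refine iSup_le fun j => (Submodule.mul_le.2 fun a ha b hb => ?_)
    exact Submodule.mem_iSup_of_mem (i + j) (SetLike.mul_mem_graded ha hb)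
  rw [eq_top_iff]
  rintro a -
  obtain ⟨x, rfl⟩ := proj_surjective a
  induction x using FreeAlgebra.induction with
  | grade0 r =>
    exact Submodule.mem_iSup_of_mem 0 (proj_mem_part (mem_freePart_zero.2 ⟨r, rfl⟩))
  | grade1 i => exact Submodule.mem_iSup_of_mem 1 (proj_mem_part (ι_mem_freePart i))
  | mul a b ha hb => rw [map_mul]; exact hmul (Submodule.mul_mem_mul ha hb)
  | add a b ha hb => rw [map_add]; exact add_mem ha hb

/-- The maps `π i` play the role of projections. The separate target `N` allows them to take values
in all functions, as needed for free modules of infinite rank. -/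
theorem iSupIndep_of_linearMap {ι M N : Type*} [AddCommGroup M] [Module k M] [AddCommGroup N]
    [Module k N] {A : ι → Submodule k M} (c : M →ₗ[k] N) (hc : Function.Injective c)
    (π : ι → M →ₗ[k] N) (h : ∀ i, ∀ x ∈ A i, π i x = c x)
    (h' : ∀ i j, j ≠ i → ∀ x ∈ A j, π i x = 0) : iSupIndep A := by
  intro i
  rw [Submodule.disjoint_def]
  intro x hx hx'
  have hle : ⨆ (j) (_ : j ≠ i), A j ≤ LinearMap.ker (π i) :=
    iSup₂_le fun j hj x hx => h' i j hj x hx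
  exact hc (by rw [← h i x hx, map_zero]; exact hle hx')

theorem part_isInternal {s : ℕ} (hW : W ≤ freePart k X s) : DirectSum.IsInternal (part W) := by
  -- The degree-tracking map kills the homogeneous relations, so it descends to the quotient; its
  -- coefficients then separate the components.
  have hle : (TwoSidedIdeal.span (W : Set (FreeAlgebra k X))).ringCon ≤
      RingCon.ker (degreeHom (proj W)).toRingHom := by
    have : TwoSidedIdeal.span (W : Set (FreeAlgebra k X)) ≤
        TwoSidedIdeal.ker (degreeHom (proj W)) := by
      refine TwoSidedIdeal.span_le.2 fun w hw => ?_
      rw [SetLike.mem_coe, TwoSidedIdeal.mem_ker, degreeHom_of_mem _ (hW hw),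
        proj_eq_zero_of_mem hw, map_zero]
    intro x z hxz
    have h := this ((TwoSidedIdeal.rel_iff _ _ _).1 hxz)
    rw [TwoSidedIdeal.mem_ker, map_sub, sub_eq_zero] at h
    exact h
  have hG : ∀ d, ∀ a ∈ part W d, RingCon.liftₐ _ (degreeHom (proj W)) hle a = monomial d a := by
    rintro d _ ⟨x, hx, rfl⟩
    exact degreeHom_of_mem _ hx
  refine DirectSum.isInternal_submodule_of_iSupIndep_of_iSup_eq_top ?_ iSup_part
  refine iSupIndep_of_linearMap LinearMap.id Function.injective_id
    (fun d => ((lcoeff (Alg W) d).restrictScalars k) ∘ₗ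
      (RingCon.liftₐ _ (degreeHom (proj W)) hle).toLinearMap) (fun d a ha => ?_) fun d e hde a ha => ?_
  · simp [hG d a ha]
  · simp [hG e a ha, coeff_monomial, hde]

end Grading

/-! ### Graded isomorphisms come from linear changes of generators. -/

section Transport

variable {k : Type*} [Field k] {X Y : Type*} {W : Submodule k (FreeAlgebra k X)}
  {W' : Submodule k (FreeAlgebra k Y)}

theorem exists_lift_algHom (ε : Alg W →ₐ[k] Alg W') (hε : ∀ a ∈ part W 1, ε a ∈ part W' 1) :
    ∃ Ψ : FreeAlgebra k X →ₐ[k] FreeAlgebra k Y,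
      (∀ i, Ψ (FreeAlgebra.ι k i) ∈ freePart k Y 1) ∧ ∀ x, proj W' (Ψ x) = ε (proj W x) := by
  choose v hv hv' using fun i => mem_part_iff.1
    (hε (proj W (FreeAlgebra.ι k i)) (proj_mem_part (ι_mem_freePart i)))
  refine ⟨FreeAlgebra.lift k v, fun i => by rw [FreeAlgebra.lift_ι_apply]; exact hv i, fun x => ?_⟩
  have : (proj W').comp (FreeAlgebra.lift k v) = ε.comp (proj W) := by
    ext i
    simp [hv']
  exact DFunLike.congr_fun this x

/-- A graded isomorphism between `k⟨X⟩ / (W)` and `k⟨Y⟩ / (W')`, with relations of degree `s ≥ 2`,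
is induced by a linear change of generators that maps `W'` onto `W`. -/
theorem exists_algEquiv_of_algEquiv {s : ℕ} (hs : 1 < s) (hW : W ≤ freePart k X s)
    (hW' : W' ≤ freePart k Y s) (e : Alg W ≃ₐ[k] Alg W')
    (he : (part W 1).map e.toLinearMap = part W' 1) :
    ∃ Φ : FreeAlgebra k Y ≃ₐ[k] FreeAlgebra k X,
      (∀ i, Φ (FreeAlgebra.ι k i) ∈ freePart k X 1) ∧
      (∀ i, Φ.symm (FreeAlgebra.ι k i) ∈ freePart k Y 1) ∧ W'.map Φ.toLinearMap = W := by
  obtain ⟨Ψ, hΨ, hΨp⟩ := exists_lift_algHom (W := W) (W' := W') e fun a ha => by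
    rw [← he]; exact ⟨a, ha, rfl⟩
  obtain ⟨Φ, hΦ, hΦp⟩ := exists_lift_algHom (W := W') (W' := W) e.symm fun a ha => by
    rw [← he] at ha
    obtain ⟨b, hb, rfl⟩ := ha
    simpa using hb
  -- On a generator both sides are linear forms with the same image in the quotient. Relations start
  -- in degree `s > 1`, so the forms coincide.
  have h1 : Φ.comp Ψ = AlgHom.id k _ := by
    ext i
    refine sub_eq_zero.1 (eq_zero_of_proj_eq_zero hW hs
      (sub_mem (map_freePart_mem Φ hΦ (hΨ i)) (ι_mem_freePart i)) ?_)
    rw [map_sub, Function.comp_apply, AlgHom.comp_apply, hΦp, hΨp]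
    simp
  have h2 : Ψ.comp Φ = AlgHom.id k _ := by
    ext i
    refine sub_eq_zero.1 (eq_zero_of_proj_eq_zero hW' hs
      (sub_mem (map_freePart_mem Ψ hΨ (hΦ i)) (ι_mem_freePart i)) ?_)
    rw [map_sub, Function.comp_apply, AlgHom.comp_apply, hΨp, hΦp]
    simp
  refine ⟨AlgEquiv.ofAlgHom Φ Ψ h1 h2, hΦ, hΨ, le_antisymm ?_ fun w hw => ?_⟩
  · rintro _ ⟨w, hw, rfl⟩
    refine mem_of_proj_eq_zero hW (map_freePart_mem Φ hΦ (hW' hw)) ?_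
    exact (hΦp w).trans (by rw [proj_eq_zero_of_mem hw, map_zero])
  · refine ⟨Ψ w, mem_of_proj_eq_zero hW' (map_freePart_mem Ψ hΨ (hW hw)) ?_,
      DFunLike.congr_fun h1 w⟩
    rw [hΨp, proj_eq_zero_of_mem hw, map_zero]

end Transport

/-! ### Failure of the extra condition. -/

section ExtraCondition

variable {k : Type*} [Field k] {X : Type*}

theorem exists_of_mem_span_pair_mul {A : Type*} [Ring A] [Algebra k A] {a b x : A}
    {P : Submodule k A} (hx : x ∈ Submodule.span k {a, b} * P) :
    ∃ p ∈ P, ∃ q ∈ P, x = a * p + b * q := by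
  refine Submodule.mul_induction_on hx (fun w hw p hp => ?_) ?_
  · obtain ⟨α, β, rfl⟩ := Submodule.mem_span_pair.1 hw
    exact ⟨α • p, P.smul_mem _ hp, β • p, P.smul_mem _ hp, by
      rw [add_mul, smul_mul_assoc, smul_mul_assoc, mul_smul_comm, mul_smul_comm]⟩
  · rintro _ _ ⟨p, hp, q, hq, rfl⟩ ⟨p', hp', q', hq', rfl⟩
    exact ⟨p + p', add_mem hp hp', q + q', add_mem hq hq', by rw [mul_add, mul_add]; abel⟩

theorem exists_of_mem_mul_span_pair {A : Type*} [Ring A] [Algebra k A] {a b x : A}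
    {P : Submodule k A} (hx : x ∈ P * Submodule.span k {a, b}) :
    ∃ p ∈ P, ∃ q ∈ P, x = p * a + q * b := by
  refine Submodule.mul_induction_on hx (fun p hp w hw => ?_) ?_
  · obtain ⟨α, β, rfl⟩ := Submodule.mem_span_pair.1 hw
    exact ⟨α • p, P.smul_mem _ hp, β • p, P.smul_mem _ hp, by
      rw [mul_add, smul_mul_assoc, smul_mul_assoc, mul_smul_comm, mul_smul_comm]⟩
  · rintro _ _ ⟨p, hp, q, hq, rfl⟩ ⟨p', hp', q', hq', rfl⟩
    exact ⟨p + p', add_mem hp hp', q + q', add_mem hq hq', by rw [add_mul, add_mul]; abel⟩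

/-- The witness is `f y f`. Here `y` may be any linear form, as it is after a change of generators.
-/
theorem not_extraCondition [Fintype X] {N : ℕ} {y f : FreeAlgebra k X} (hy : y ∈ freePart k X 1)
    (hf : f ∈ freePart k X (N + 2))
    (hind : ∀ α β : k, α • (y * f) + β • (f * y) = 0 → α = 0 ∧ β = 0)
    (hsyz : ∀ a ∈ freePart k X 1, ∀ b ∈ freePart k X 1, ∀ c ∈ freePart k X 1,
      ∀ d ∈ freePart k X 1, y * f * a + f * y * b = c * (y * f) + d * (f * y) → b = 0) :
    ¬ ExtraCondition (N + 3) (Submodule.span k {y * f, f * y}) := by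
  classical
  intro h
  have hyf : y * f ∈ freePart k X (N + 3) := mul_mem_freePart hy hf (by ring)
  have hfy : f * y ∈ freePart k X (N + 3) := mul_mem_freePart hf hy rfl
  have hmem : f * y * f ∈ ((Submodule.span k {y * f, f * y} * freePart k X 1) ⊓
      (freePart k X 1 * Submodule.span k {y * f, f * y})) * freePart k X (N + 3 - 2) := by
    rw [← h]
    refine ⟨Submodule.mul_mem_mul (Submodule.subset_span (by simp)) hf, ?_⟩
    -- With `s = N + 3`, the last summand `i = s - 2` is the one that accommodates `f · (y f)`.
    have hle : freePart k X (N + 1) * Submodule.span k {y * f, f * y} * freePart k X 0 ≤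
        ∑ i ∈ Finset.range (N + 3 - 1), freePart k X i * Submodule.span k {y * f, f * y} *
          freePart k X (N + 3 - 2 - i) := by
      have := Finset.single_le_sum (f := fun i => freePart k X i *
        Submodule.span k {y * f, f * y} * freePart k X (N + 3 - 2 - i)) (fun _ _ => bot_le)
        (Finset.mem_range.2 (show N + 1 < N + 3 - 1 by omega))
      simpa using this
    rw [freePart_zero, mul_one] at hle
    refine mul_le_mul_right hle _ ?_
    rw [← mul_assoc, ← freePart_add, mul_assoc, add_comm 1]
    exact Submodule.mul_mem_mul hf (Submodule.subset_span (by simp))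
  -- An element of `W V ∩ V W` is exactly a linear syzygy, so its component `f y b` vanishes and
  -- only `y f a` is left.
  have hJ : ((Submodule.span k {y * f, f * y} * freePart k X 1) ⊓
      (freePart k X 1 * Submodule.span k {y * f, f * y})) * freePart k X (N + 3 - 2) ≤
      LinearMap.range (LinearMap.mulLeft k (y * f)) := by
    refine Submodule.mul_le.2 fun x hx z _ => ?_
    obtain ⟨a, ha, b, hb, rfl⟩ := exists_of_mem_span_pair_mul hx.1
    obtain ⟨c, hc, d, hd, he⟩ := exists_of_mem_mul_span_pair hx.2
    rw [hsyz a ha b hb c hc d hd he, mul_zero, add_zero, mul_assoc]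
    exact ⟨_, rfl⟩
  obtain ⟨p, hp⟩ := hJ hmem
  have hp' : y * f * p = f * y * f := hp
  have := (eq_zero_of_mul_add_mul_eq_zero (p := -p) (q := f) hyf hfy hind
    (by rw [mul_neg, hp', neg_add_cancel])).2
  exact one_ne_zero (hind 1 0 (by simp [this])).1

end ExtraCondition

/-! ### Graded right modules, generators of a kernel, and the construction of resolutions. -/

section GradedModules

variable {k : Type u} {Λ : Type v} [Field k] [Ring Λ] [Algebra k Λ] {𝒜 : ℕ → Submodule k Λ}

namespace GrMod

variable (M N : GrMod 𝒜)

/-- The projection of a graded module onto its component of degree `l`. -/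
noncomputable def comp (l : ℤ) : M.carrier →ₗ[k] M.carrier :=
  letI := M.isInternal.chooseDecomposition
  (M.deg l).subtype ∘ₗ DirectSum.component k ℤ (fun j => M.deg j) l ∘ₗ
    (DirectSum.decomposeLinearEquiv M.deg).toLinearMap

theorem comp_mem (l : ℤ) (x : M.carrier) : M.comp l x ∈ M.deg l := Subtype.coe_prop _

variable {M N}

theorem comp_of_mem {l : ℤ} {x : M.carrier} (hx : x ∈ M.deg l) : M.comp l x = x :=
  letI := M.isInternal.chooseDecomposition
  DirectSum.decompose_of_mem_same M.deg hx

theorem comp_of_mem_ne {l j : ℤ} {x : M.carrier} (hx : x ∈ M.deg j) (h : j ≠ l) :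
    M.comp l x = 0 :=
  letI := M.isInternal.chooseDecomposition
  DirectSum.decompose_of_mem_ne M.deg hx h

theorem mem_of_comp_mem {U : Submodule k M.carrier} {x : M.carrier} (h : ∀ l, M.comp l x ∈ U) :
    x ∈ U := by
  classical
  let _ := M.isInternal.chooseDecomposition
  rw [← DirectSum.sum_support_decompose M.deg x]
  exact sum_mem fun l _ => h l

theorem homogeneous_induction {p : M.carrier → Prop} (x : M.carrier) (zero : p 0)
    (homogeneous : ∀ (l : ℤ) (z : M.carrier), z ∈ M.deg l → p z)
    (add : ∀ a b, p a → p b → p (a + b)) : p x := by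
  let _ := M.isInternal.chooseDecomposition
  exact DirectSum.Decomposition.inductionOn M.deg zero (fun {l} z => homogeneous l z z.2) add x

theorem comp_map {g : N.carrier →ₗ[Λᵐᵒᵖ] M.carrier}
    (hg : ∀ (j : ℤ) (p : N.carrier), p ∈ N.deg j → g p ∈ M.deg j) (l : ℤ) (x : N.carrier) :
    M.comp l (g x) = g (N.comp l x) := by
  refine homogeneous_induction (p := fun x => M.comp l (g x) = g (N.comp l x)) x (by simp)
    (fun j z hz => ?_) fun a b ha hb => by simp only [map_add, ha, hb]
  by_cases h : j = l
  · subst h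
    rw [comp_of_mem hz, comp_of_mem (hg j z hz)]
  · rw [comp_of_mem_ne hz h, comp_of_mem_ne (hg j z hz) h, map_zero]

theorem comp_smul {d : ℕ} {a : Λ} (ha : a ∈ 𝒜 d) (l : ℤ) (x : M.carrier) :
    M.comp l (MulOpposite.op a • x) = MulOpposite.op a • M.comp (l - d) x := by
  refine homogeneous_induction
    (p := fun x => M.comp l (MulOpposite.op a • x) = MulOpposite.op a • M.comp (l - d) x) x (by simp)
    (fun j z hz => ?_) fun a b ha hb => by simp only [smul_add, map_add, ha, hb]
  have hz' := M.smul_mem d j a z ha hz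
  by_cases h : j + d = l
  · subst h
    rw [comp_of_mem hz', add_sub_cancel_right, comp_of_mem hz]
  · rw [comp_of_mem_ne hz' h, comp_of_mem_ne hz (fun h' => h (by omega)), smul_zero]

end GrMod

/-- Let `K` be the kernel of the `i`-th differential of a resolution. If the functionals on
`P (i + 1)` that factor through the trivial module vanish on `K`, and `Ext^{i+2}` is concentrated
in degree `-c`, then `K` is generated by its component of degree `c`. -/
theorem GrRes.mem_span_of_extPartIsZero (R : GrRes 𝒜) {i : ℕ} {b c : ℤ}
    (hbot : ∀ l < b, ∀ x ∈ (R.P (i + 1)).deg l, x = 0)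
    (hmin : ∀ l, ∀ x ∈ (R.P (i + 1)).deg l, R.d i x = 0 →
      ∀ ψ ∈ (R.P (i + 1)).homTrivial (-l), ψ x = 0)
    (hext : ∀ e : ℤ, e ≠ -c → R.ExtPartIsZero (i + 2) e) {l : ℤ} {x : (R.P (i + 1)).carrier}
    (hx : x ∈ (R.P (i + 1)).deg l) (hdx : R.d i x = 0) :
    x ∈ Submodule.span Λᵐᵒᵖ {z | z ∈ (R.P (i + 1)).deg c ∧ R.d i z = 0} := by
  obtain ⟨n, hn⟩ : ∃ n : ℕ, l < b + n := ⟨(l - b + 1).toNat, by omega⟩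
  induction n generalizing l x with
  | zero =>
    rw [hbot l (by simpa using hn) x hx]
    exact zero_mem _
  | succ n ih =>
    by_cases hlc : l = c
    · exact Submodule.subset_span ⟨hlc ▸ hx, hdx⟩
    set K := Submodule.span Λᵐᵒᵖ {z | z ∈ (R.P (i + 1)).deg c ∧ R.d i z = 0} with hK
    by_contra hxK
    -- If `x` is a new generator in degree `l ≠ c`, a functional separating it from `K` yields a
    -- cocycle `φ` of degree `-l`. It vanishes on multiples by positive-degree elements because
    -- kernel elements of smaller degree already lie in `K`. As a coboundary, `φ` comes from some
    -- `ψ` that `hmin` makes vanish at `x`, a contradiction.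
    obtain ⟨θ, hθx, hθK⟩ := Submodule.exists_le_ker_of_notMem (p := K.restrictScalars k) hxK
    let φ : (R.P (i + 2)).carrier →ₗ[k] k :=
      θ ∘ₗ (R.P (i + 1)).comp l ∘ₗ (R.d (i + 1)).restrictScalars k
    have hφ : φ ∈ R.cocycles (i + 2) (-l) := by
      refine ⟨⟨fun d a p hd ha => ?_, fun j p hp hj => ?_⟩, ?_⟩
      · have hK' : MulOpposite.op a • (R.P (i + 1)).comp (l - d) (R.d (i + 1) p) ∈ K := by
          refine K.smul_mem _ (ih ((R.P (i + 1)).comp_mem _ _) ?_ (by push_cast at hn; omega))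
          rw [← GrMod.comp_map (R.d_mem i), (R.exact_d i).apply_apply_eq_zero, map_zero]
        change θ ((R.P (i + 1)).comp l (R.d (i + 1) (MulOpposite.op a • p))) = 0
        rw [map_smul, GrMod.comp_smul ha]
        exact hθK hK'
      · change θ ((R.P (i + 1)).comp l (R.d (i + 1) p)) = 0
        rw [GrMod.comp_of_mem_ne (R.d_mem (i + 1) j p hp) (fun h => hj (by omega)), map_zero]
      · refine LinearMap.ext fun p => ?_
        change θ ((R.P (i + 1)).comp l (R.d (i + 1) (R.d (i + 2) p))) = 0
        rw [(R.exact_d (i + 1)).apply_apply_eq_zero, map_zero, map_zero]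
    obtain ⟨ψ, hψ, hψφ⟩ := hext (-l) (fun h => hlc (neg_injective h)) hφ
    obtain ⟨p, rfl⟩ := (R.exact_d i x).1 hdx
    refine hθx ?_
    have h1 : φ p = ψ (R.d (i + 1) p) := by rw [← hψφ]; rfl
    have h2 : φ p = θ (R.d (i + 1) p) := by
      change θ ((R.P (i + 1)).comp l (R.d (i + 1) p)) = _
      rw [GrMod.comp_of_mem hx]
    rw [← h2, h1]
    exact hmin l _ hx hdx ψ hψ

/-- The components of a graded algebra, with zero in negative degrees. -/
def intPart (𝒜 : ℕ → Submodule k Λ) (j : ℤ) : Submodule k Λ := if 0 ≤ j then 𝒜 j.toNat else ⊥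

theorem intPart_natCast (d : ℕ) : intPart 𝒜 d = 𝒜 d := by simp [intPart]

theorem intPart_of_neg {j : ℤ} (h : j < 0) : intPart 𝒜 j = ⊥ := by
  rw [intPart, if_neg (by omega)]

theorem exists_of_mem_intPart {j : ℤ} {a : Λ} (ha : a ∈ intPart 𝒜 j) :
    a = 0 ∨ ∃ d : ℕ, j = d ∧ a ∈ 𝒜 d := by
  rcases lt_or_ge j 0 with h | h
  · rw [intPart_of_neg h] at ha
    exact Or.inl ha
  · lift j to ℕ using h
    rw [intPart_natCast] at ha
    exact Or.inr ⟨j, rfl, ha⟩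

instance : IsScalarTower k Λᵐᵒᵖ Λ where
  smul_assoc c a x := by
    change x * (c • a).unop = c • (x * a.unop)
    rw [MulOpposite.unop_smul, mul_smul_comm]

variable [GradedAlgebra 𝒜]

theorem mul_mem_intPart {d : ℕ} {j : ℤ} {a x : Λ} (ha : a ∈ 𝒜 d) (hx : x ∈ intPart 𝒜 j) :
    x * a ∈ intPart 𝒜 (j + d) := by
  obtain rfl | ⟨e, rfl, he⟩ := exists_of_mem_intPart hx
  · rw [zero_mul]; exact zero_mem _
  · rw [← Nat.cast_add, intPart_natCast]
    exact SetLike.mul_mem_graded he ha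

variable (𝒜) in
/-- The free graded right module with a basis of homogeneous elements of degrees `δ i`. -/
noncomputable def GrMod.free (ι : Type v) (δ : ι → ℤ) : GrMod 𝒜 where
  carrier := ι →₀ Λ
  deg j := ⨅ i, (intPart 𝒜 (j - δ i)).comap (Finsupp.lapply i)
  isInternal := by
    classical
    refine DirectSum.isInternal_submodule_of_iSupIndep_of_iSup_eq_top ?_ ?_
    · refine iSupIndep_of_linearMap (Finsupp.lcoeFun (R := k)) DFunLike.coe_injective
        (fun j => LinearMap.pi fun i =>
          (if 0 ≤ j - δ i then GradedAlgebra.proj 𝒜 (j - δ i).toNat else 0) ∘ₗ Finsupp.lapply i)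
        (fun j φ hφ => funext fun i => ?_) fun j l hjl φ hφ => funext fun i => ?_
      · have h := exists_of_mem_intPart ((Submodule.mem_iInf _).1 hφ i)
        simp only [Finsupp.lapply_apply] at h
        obtain h0 | ⟨d, hd, ha⟩ := h
        · simp [h0]
        · have hle : δ i ≤ j := by omega
          simp [hd, hle, GradedAlgebra.proj_apply, DirectSum.decompose_of_mem_same 𝒜 ha]
      · have h := exists_of_mem_intPart ((Submodule.mem_iInf _).1 hφ i)
        simp only [Finsupp.lapply_apply] at h
        obtain h0 | ⟨d, hd, ha⟩ := h
        · simp [h0]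
        · by_cases hj : 0 ≤ j - δ i
          · have hne : d ≠ (j - δ i).toNat := fun h => hjl (by omega)
            simp only [LinearMap.pi_apply, LinearMap.comp_apply, Finsupp.lapply_apply, if_pos hj,
              GradedAlgebra.proj_apply, DirectSum.decompose_of_mem_ne 𝒜 ha hne, Pi.zero_apply]
          · have hle : ¬ δ i ≤ j := by omega
            simp [hle]
    · rw [eq_top_iff]
      rintro φ -
      induction φ using Finsupp.induction_linear with
      | zero => exact zero_mem _
      | add a b ha hb => exact add_mem ha hb
      | single i a =>
        refine DirectSum.Decomposition.inductionOn 𝒜 (motive := fun a =>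
          Finsupp.single i a ∈ ⨆ j, ⨅ i, (intPart 𝒜 (j - δ i)).comap (Finsupp.lapply i))
          ?_ (fun {d} a => ?_) (fun a b ha hb => ?_) a
        · rw [Finsupp.single_zero]; exact zero_mem _
        · refine Submodule.mem_iSup_of_mem (δ i + d) ((Submodule.mem_iInf _).2 fun i' => ?_)
          rw [Submodule.mem_comap, Finsupp.lapply_apply]
          by_cases h : i = i'
          · subst h
            rw [Finsupp.single_eq_same, add_sub_cancel_left, intPart_natCast]
            exact a.2
          · rw [Finsupp.single_eq_of_ne' h]
            exact zero_mem _
        · rw [Finsupp.single_add]; exact add_mem ha hb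
  smul_mem d j a φ ha hφ := by
    refine (Submodule.mem_iInf _).2 fun i => ?_
    have h := mul_mem_intPart ha ((Submodule.mem_iInf _).1 hφ i)
    rwa [sub_add_eq_add_sub] at h

namespace GrMod

variable {ι : Type v} {δ : ι → ℤ} {M N : GrMod 𝒜}

theorem mem_free_deg {j : ℤ} {φ : ι →₀ Λ} :
    φ ∈ (free 𝒜 ι δ).deg j ↔ ∀ i, φ i ∈ intPart 𝒜 (j - δ i) :=
  Submodule.mem_iInf _

/-- The right linear isomorphism of `Λ` with the left module `Λᵐᵒᵖ` over `Λᵐᵒᵖ`. -/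
def opEquiv : Λᵐᵒᵖ ≃ₗ[Λᵐᵒᵖ] Λ where
  toFun := MulOpposite.unop
  invFun := MulOpposite.op
  map_add' _ _ := rfl
  map_smul' _ _ := rfl
  left_inv _ := rfl
  right_inv _ := rfl

theorem free_projective : Module.Projective Λᵐᵒᵖ (free 𝒜 ι δ).carrier := by
  have : Module.Free Λᵐᵒᵖ Λ := Module.Free.of_equiv opEquiv
  exact inferInstanceAs (Module.Projective Λᵐᵒᵖ (ι →₀ Λ))

/-- The homomorphism from a free right module given by the images of the basis elements. -/
noncomputable def lift (m : ι → M.carrier) : (free 𝒜 ι δ).carrier →ₗ[Λᵐᵒᵖ] M.carrier :=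
  Finsupp.lsum ℕ fun i => LinearMap.toSpanSingleton Λᵐᵒᵖ M.carrier (m i) ∘ₗ opEquiv.symm.toLinearMap

theorem lift_apply (m : ι → M.carrier) (φ : ι →₀ Λ) :
    lift (δ := δ) m φ = φ.sum fun i a => MulOpposite.op a • m i := rfl

theorem lift_single (m : ι → M.carrier) (i : ι) (a : Λ) :
    lift (δ := δ) m (Finsupp.single i a) = MulOpposite.op a • m i := by
  rw [lift_apply, Finsupp.sum_single_index]
  rw [MulOpposite.op_zero, zero_smul]

theorem lift_mem {m : ι → M.carrier} (hm : ∀ i, m i ∈ M.deg (δ i)) (j : ℤ)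
    (φ : (free 𝒜 ι δ).carrier) (hφ : φ ∈ (free 𝒜 ι δ).deg j) : lift m φ ∈ M.deg j := by
  rw [lift_apply m φ]
  refine Submodule.sum_mem _ fun i _ => ?_
  obtain h0 | ⟨d, hd, ha⟩ := exists_of_mem_intPart (mem_free_deg.1 hφ i)
  · beta_reduce
    rw [h0, MulOpposite.op_zero, zero_smul]; exact zero_mem _
  · have := M.smul_mem d _ _ _ ha (hm i)
    rwa [show δ i + d = j by omega] at this

/-- The coefficient of an element of a free module at a basis element. -/
noncomputable def coeff (i : ι) : (free 𝒜 ι δ).carrier →ₗ[Λᵐᵒᵖ] Λ := Finsupp.lapply i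

theorem coeff_ext {x z : (free 𝒜 ι δ).carrier} (h : ∀ i, coeff i x = coeff i z) : x = z :=
  Finsupp.ext h

theorem mem_free_deg_iff_coeff {j : ℤ} {x : (free 𝒜 ι δ).carrier} :
    x ∈ (free 𝒜 ι δ).deg j ↔ ∀ i, coeff i x ∈ intPart 𝒜 (j - δ i) :=
  mem_free_deg

/-- The element of a free module of finite rank with given coefficients. -/
noncomputable def ofCoeff [Finite ι] (c : ι → Λ) : (free 𝒜 ι δ).carrier :=
  Finsupp.equivFunOnFinite.symm c

theorem coeff_ofCoeff [Finite ι] (c : ι → Λ) (i : ι) :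
    coeff i (ofCoeff c : (free 𝒜 ι δ).carrier) = c i := rfl

theorem lift_eq_sum [Fintype ι] (m : ι → M.carrier) (x : (free 𝒜 ι δ).carrier) :
    lift m x = ∑ i, MulOpposite.op (coeff i x) • m i := by
  rw [lift_apply m x]
  exact Finsupp.sum_fintype _ _ fun i => by rw [MulOpposite.op_zero, zero_smul]

theorem coeff_lift [Fintype ι] {κ : Type v} {ε : κ → ℤ} (m : ι → (free 𝒜 κ ε).carrier)
    (x : (free 𝒜 ι δ).carrier) (j : κ) :
    coeff j (lift m x) = ∑ i, coeff j (m i) * coeff i x := by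
  rw [lift_eq_sum, map_sum]
  exact Finset.sum_congr rfl fun i _ => map_smul _ _ _

theorem eq_sum_smul [Fintype ι] [DecidableEq ι] (x : (free 𝒜 ι δ).carrier) :
    x = ∑ i, MulOpposite.op (coeff i x) • ofCoeff (Pi.single i 1) := by
  refine coeff_ext fun j => ?_
  rw [map_sum, Finset.sum_eq_single j]
  · rw [map_smul, coeff_ofCoeff, Pi.single_eq_same]
    exact (one_mul _).symm
  · intro i _ hij
    rw [map_smul, coeff_ofCoeff, Pi.single_eq_of_ne hij.symm, smul_zero]
  · simp

/-- The cover is free on all homogeneous elements of the kernel. It is far from minimal, which is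
harmless: minimality matters only for the explicit first terms of the resolution. -/
theorem exists_projective_cover_ker (g : N.carrier →ₗ[Λᵐᵒᵖ] M.carrier)
    (hg : ∀ (j : ℤ) (p : N.carrier), p ∈ N.deg j → g p ∈ M.deg j) :
    ∃ (P : GrMod 𝒜) (h : P.carrier →ₗ[Λᵐᵒᵖ] N.carrier), Module.Projective Λᵐᵒᵖ P.carrier ∧
      (∀ (j : ℤ) (p : P.carrier), p ∈ P.deg j → h p ∈ N.deg j) ∧ Function.Exact h g := by
  let ι := {p : N.carrier × ℤ // p.1 ∈ N.deg p.2 ∧ g p.1 = 0}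
  refine ⟨free 𝒜 ι fun i => i.1.2, lift fun i => i.1.1, free_projective,
    lift_mem fun i => i.2.1, fun x => ⟨fun hx => ?_, ?_⟩⟩
  · refine mem_of_comp_mem (U := (LinearMap.range (lift fun i : ι => i.1.1)).restrictScalars k)
      fun l => ⟨Finsupp.single ⟨(N.comp l x, l), N.comp_mem l x, ?_⟩ 1, ?_⟩
    · rw [← comp_map hg, hx, map_zero]
    · rw [lift_single, MulOpposite.op_one, one_smul]
  · rintro ⟨φ, rfl⟩
    refine (congrArg g (lift_apply (fun i : ι => i.1.1) φ)).trans ?_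
    simp only [Finsupp.sum, map_sum]
    exact Finset.sum_eq_zero fun i _ => by rw [map_smul, i.2.2, smul_zero]

end GrMod

variable (𝒜) in
/-- A homomorphism of graded modules, as a stage in the construction of a resolution. -/
structure GrArrow where
  tgt : GrMod 𝒜
  src : GrMod 𝒜
  hom : src.carrier →ₗ[Λᵐᵒᵖ] tgt.carrier
  hom_mem : ∀ (j : ℤ) (p : src.carrier), p ∈ src.deg j → hom p ∈ tgt.deg j
  projective : Module.Projective Λᵐᵒᵖ src.carrier

/-- A projective cover of the kernel. -/
noncomputable def GrArrow.next (g : GrArrow 𝒜) : GrArrow 𝒜 where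
  tgt := g.src
  src := (GrMod.exists_projective_cover_ker g.hom g.hom_mem).choose
  hom := (GrMod.exists_projective_cover_ker g.hom g.hom_mem).choose_spec.choose
  hom_mem := (GrMod.exists_projective_cover_ker g.hom g.hom_mem).choose_spec.choose_spec.2.1
  projective := (GrMod.exists_projective_cover_ker g.hom g.hom_mem).choose_spec.choose_spec.1

theorem GrArrow.exact_next (g : GrArrow 𝒜) : Function.Exact g.next.hom g.hom :=
  (GrMod.exists_projective_cover_ker g.hom g.hom_mem).choose_spec.choose_spec.2.2

/-- The arrows of the resolution that continues a given arrow. -/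
noncomputable def GrArrow.iter (g : GrArrow 𝒜) : ℕ → GrArrow 𝒜
  | 0 => g
  | n + 1 => (g.iter n).next

/-- The resolution of the trivial module that continues `P₂ → P₁ → P₀ → k`. -/
noncomputable def GrArrow.resolution (g : GrArrow 𝒜) (hproj : Module.Projective Λᵐᵒᵖ g.tgt.carrier)
    (P₀ : GrMod 𝒜) (hproj₀ : Module.Projective Λᵐᵒᵖ P₀.carrier)
    (d₀ : g.tgt.carrier →ₗ[Λᵐᵒᵖ] P₀.carrier)
    (hd₀ : ∀ (j : ℤ) (p : g.tgt.carrier), p ∈ g.tgt.deg j → d₀ p ∈ P₀.deg j)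
    (aug : P₀.carrier →ₗ[k] k) (aug_mem : aug ∈ P₀.homTrivial 0)
    (aug_surjective : Function.Surjective aug) (exact_aug : Function.Exact d₀ aug)
    (exact₀ : Function.Exact g.hom d₀) : GrRes 𝒜 where
  P
    | 0 => P₀
    | n + 1 => (g.iter n).tgt
  projective
    | 0 => hproj₀
    | 1 => hproj
    | n + 2 => (g.iter n).projective
  d
    | 0 => d₀
    | n + 1 => (g.iter n).hom
  d_mem
    | 0 => hd₀
    | n + 1 => (g.iter n).hom_mem
  aug := aug
  aug_mem := aug_mem
  aug_surjective := aug_surjective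
  exact_aug := exact_aug
  exact_d
    | 0 => exact₀
    | n + 1 => (g.iter n).exact_next

end GradedModules

/-! ### The augmentation and the first-letter decomposition of the ideal. -/

section Augmentation

variable {k : Type*} [Field k] {X : Type*}

theorem algebraMapInv_eq_zero_of_mem {d : ℕ} {x : FreeAlgebra k X}
    (hx : x ∈ freePart k X (d + 1)) : FreeAlgebra.algebraMapInv x = 0 := by
  refine freePart_succ_induction (p := fun x => FreeAlgebra.algebraMapInv x = 0) hx
    (fun i w _ => ?_) (map_zero _) fun a b ha hb => by rw [map_add, ha, hb, add_zero]
  rw [map_mul, FreeAlgebra.algebraMapInv, FreeAlgebra.lift_ι_apply, Pi.zero_apply, zero_mul]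

theorem exists_eq_algebraMap_add_sum [Fintype X] (x : FreeAlgebra k X) :
    ∃ q : X → FreeAlgebra k X, x = algebraMap k _ (FreeAlgebra.algebraMapInv x) +
      ∑ i, FreeAlgebra.ι k i * q i := by
  classical
  induction x using FreeAlgebra.induction with
  | grade0 r => exact ⟨0, by simp⟩
  | grade1 j =>
    refine ⟨fun i => if i = j then 1 else 0, ?_⟩
    simp [FreeAlgebra.algebraMapInv]
  | mul a b ha hb =>
    obtain ⟨p, hp⟩ := ha
    obtain ⟨q, hq⟩ := hb
    refine ⟨fun i => FreeAlgebra.algebraMapInv a • q i + p i * b, ?_⟩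
    simp only [mul_add, Finset.sum_add_distrib, mul_smul_comm, ← Finset.smul_sum, ← mul_assoc,
      ← Finset.sum_mul, map_mul]
    rw [← add_assoc, Algebra.smul_def, ← mul_add, ← hq, ← add_mul, ← hp]
  | add a b ha hb =>
    obtain ⟨p, hp⟩ := ha
    obtain ⟨q, hq⟩ := hb
    refine ⟨fun i => p i + q i, ?_⟩
    simp only [mul_add, Finset.sum_add_distrib, map_add]
    rw [add_add_add_comm, ← hp, ← hq]

/-- The two-sided ideal generated by `a` and `b` is `a k⟨X⟩ + b k⟨X⟩ + V I`. -/
theorem exists_of_mem_span_pair [Fintype X] {a b x : FreeAlgebra k X}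
    (hx : x ∈ TwoSidedIdeal.span (Submodule.span k {a, b} : Set (FreeAlgebra k X))) :
    ∃ (p q : FreeAlgebra k X) (z : X → FreeAlgebra k X),
      (∀ i, proj (Submodule.span k {a, b}) (z i) = 0) ∧
      x = a * p + b * q + ∑ i, FreeAlgebra.ι k i * z i := by
  induction hx using TwoSidedIdeal.span_induction with
  | mem x hx =>
    obtain ⟨α, β, rfl⟩ := Submodule.mem_span_pair.1 hx
    exact ⟨α • 1, β • 1, 0, by simp, by simp⟩
  | zero => exact ⟨0, 0, 0, by simp, by simp⟩
  | add x y _ _ hx hy =>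
    obtain ⟨p, q, z, hz, rfl⟩ := hx
    obtain ⟨p', q', z', hz', rfl⟩ := hy
    refine ⟨p + p', q + q', z + z', fun i => by simp [hz, hz'], ?_⟩
    simp only [Pi.add_apply, mul_add, Finset.sum_add_distrib]
    abel
  | neg x _ hx =>
    obtain ⟨p, q, z, hz, rfl⟩ := hx
    refine ⟨-p, -q, -z, fun i => by simp [hz], ?_⟩
    simp only [Pi.neg_apply, mul_neg, Finset.sum_neg_distrib]
    abel
  | left_absorb c x hmem hx =>
    obtain ⟨p, q, z, hz, hxe⟩ := hx
    -- Splitting `c` as `ε(c) + ∑ xᵢ rᵢ`, the part `∑ xᵢ (rᵢ x)` of `c x` goes into `V I`, since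
    -- each `rᵢ x` is in the ideal `I`.
    obtain ⟨r, hr⟩ := exists_eq_algebraMap_add_sum c
    refine ⟨FreeAlgebra.algebraMapInv c • p, FreeAlgebra.algebraMapInv c • q,
      fun i => FreeAlgebra.algebraMapInv c • z i + r i * x, fun i => ?_, ?_⟩
    · rw [map_add, map_smul, hz, map_mul, proj_eq_zero_iff.2 hmem, smul_zero, mul_zero, add_zero]
    · conv_lhs => rw [hr, add_mul, ← Algebra.smul_def, Finset.sum_mul]
      conv_lhs => enter [1]; rw [hxe]
      simp only [mul_add, Finset.sum_add_distrib, mul_smul_comm, ← Finset.smul_sum, smul_add,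
        mul_assoc, add_assoc]
  | right_absorb c x _ hx =>
    obtain ⟨p, q, z, hz, rfl⟩ := hx
    refine ⟨p * c, q * c, fun i => z i * c, fun i => by rw [map_mul, hz, zero_mul], ?_⟩
    simp only [add_mul, Finset.sum_mul, mul_assoc]

/-- The augmentation of `k⟨X⟩ / (W)`, for `W` in positive degree. -/
noncomputable def augmentation {W : Submodule k (FreeAlgebra k X)} {s : ℕ}
    (hW : W ≤ freePart k X (s + 1)) : Alg W →ₐ[k] k :=
  RingCon.liftₐ _ FreeAlgebra.algebraMapInv (by
    have : TwoSidedIdeal.span (W : Set (FreeAlgebra k X)) ≤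
        TwoSidedIdeal.ker (FreeAlgebra.algebraMapInv : FreeAlgebra k X →ₐ[k] k) :=
      TwoSidedIdeal.span_le.2 fun w hw =>
        (TwoSidedIdeal.mem_ker _).2 (algebraMapInv_eq_zero_of_mem (hW hw))
    intro x z hxz
    have h := this ((TwoSidedIdeal.rel_iff _ _ _).1 hxz)
    rw [TwoSidedIdeal.mem_ker, map_sub, sub_eq_zero] at h
    exact h)

theorem augmentation_proj {W : Submodule k (FreeAlgebra k X)} {s : ℕ}
    (hW : W ≤ freePart k X (s + 1)) (x : FreeAlgebra k X) :
    augmentation hW (proj W x) = FreeAlgebra.algebraMapInv x := rfl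

theorem augmentation_of_mem {W : Submodule k (FreeAlgebra k X)} {s : ℕ}
    (hW : W ≤ freePart k X (s + 1)) {d : ℕ} (hd : d ≠ 0) {a : Alg W} (ha : a ∈ part W d) :
    augmentation hW a = 0 := by
  obtain ⟨x, hx, rfl⟩ := mem_part_iff.1 ha
  obtain ⟨d, rfl⟩ := Nat.exists_eq_succ_of_ne_zero hd
  exact algebraMapInv_eq_zero_of_mem hx

end Augmentation

/-! ### The start of the resolution for two relators, and failure of Koszulity. -/

section Resolution

variable {k : Type u} [Field k] {n : ℕ} {W : Submodule k (FreeAlgebra k (Fin n))}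
  [GradedAlgebra (part W)]

open GrMod

variable (W) in
/-- The free module of rank one. -/
noncomputable abbrev freeZero : GrMod (part W) := free (part W) PUnit fun _ => 0

variable (W) in
/-- The graded module `V ⊗ Λ`. -/
noncomputable abbrev freeOne : GrMod (part W) := free (part W) (ULift.{u} (Fin n)) fun _ => 1

variable (W) in
/-- The free graded module with two generators of degree `s`. -/
noncomputable abbrev freeTwo (s : ℕ) : GrMod (part W) := free (part W) (ULift.{u} Bool) fun _ => s

/-- The multiplication `V ⊗ Λ → Λ`. -/
noncomputable def diffZero : (freeOne W).carrier →ₗ[(Alg W)ᵐᵒᵖ] (freeZero W).carrier :=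
  lift (M := freeZero W) fun i => ofCoeff fun _ => proj W (FreeAlgebra.ι k i.down)

/-- The map that sends the two generators to the images of the relations `a` and `b` under
`V ⊗ k⟨X⟩ → V ⊗ Λ`. -/
noncomputable def diffOne (s : ℕ) (a b : FreeAlgebra k (Fin n)) :
    (freeTwo W s).carrier →ₗ[(Alg W)ᵐᵒᵖ] (freeOne W).carrier :=
  lift (M := freeOne W) fun t => ofCoeff fun i => proj W (leftDeriv i.down (bif t.down then a else b))

theorem coeff_diffZero (x : (freeOne W).carrier) :
    coeff PUnit.unit (diffZero x) = ∑ i, proj W (FreeAlgebra.ι k i) * coeff ⟨i⟩ x := by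
  refine (coeff_lift _ x _).trans ?_
  exact Fintype.sum_equiv Equiv.ulift _ _ fun i => rfl

theorem coeff_diffOne {s : ℕ} {a b : FreeAlgebra k (Fin n)} (x : (freeTwo W s).carrier)
    (i : Fin n) : coeff ⟨i⟩ (diffOne s a b x) =
      proj W (leftDeriv i a) * coeff ⟨true⟩ x + proj W (leftDeriv i b) * coeff ⟨false⟩ x := by
  refine (coeff_lift _ x _).trans ?_
  refine (Fintype.sum_equiv Equiv.ulift _ (fun t : Bool =>
    proj W (leftDeriv i (bif t then a else b)) * coeff ⟨t⟩ x) fun t => rfl).trans ?_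
  exact Fintype.sum_bool _

theorem diffZero_mem (j : ℤ) (p : (freeOne W).carrier) (hp : p ∈ (freeOne W).deg j) :
    diffZero p ∈ (freeZero W).deg j := by
  refine lift_mem (fun i => mem_free_deg_iff_coeff.2 fun _ => ?_) j p hp
  rw [coeff_ofCoeff, sub_zero, ← Nat.cast_one, intPart_natCast]
  exact proj_mem_part (ι_mem_freePart _)

theorem diffOne_mem {s : ℕ} {a b : FreeAlgebra k (Fin n)} (ha : a ∈ freePart k (Fin n) (s + 1))
    (hb : b ∈ freePart k (Fin n) (s + 1)) (j : ℤ) (p : (freeTwo W (s + 1)).carrier)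
    (hp : p ∈ (freeTwo W (s + 1)).deg j) : diffOne (s + 1) a b p ∈ (freeOne W).deg j := by
  refine lift_mem (fun t => mem_free_deg_iff_coeff.2 fun i => ?_) j p hp
  rw [coeff_ofCoeff, Nat.cast_add, Nat.cast_one, add_sub_cancel_right, intPart_natCast]
  refine proj_mem_part (leftDeriv_mem _ ?_)
  cases t.down
  exacts [hb, ha]

/-- A kernel element lifts to `pᵢ` with `∑ xᵢ pᵢ` in the ideal `I = a k⟨X⟩ + b k⟨X⟩ + V I`. Left
derivatives recover the `pᵢ`, and the `V I` part dies in `Λ`. -/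
theorem exact_diffOne_diffZero {s : ℕ} {a b : FreeAlgebra k (Fin n)}
    (ha : a ∈ freePart k (Fin n) (s + 1)) (hb : b ∈ freePart k (Fin n) (s + 1))
    (hW : W = Submodule.span k {a, b}) :
    Function.Exact (diffOne (W := W) (s + 1) a b) diffZero := by
  intro x
  constructor
  · intro hx
    choose p hp using fun i => proj_surjective (W := W) (coeff ⟨i⟩ x)
    have h0 : proj W (∑ i, FreeAlgebra.ι k i * p i) = 0 := by
      rw [map_sum]
      simp only [map_mul, hp]
      rw [← coeff_diffZero, hx, map_zero]
    rw [proj_eq_zero_iff, hW] at h0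
    obtain ⟨q, r, z, hz, he⟩ := exists_of_mem_span_pair h0
    rw [← hW] at hz
    refine ⟨ofCoeff fun t => bif t.down then proj W q else proj W r, coeff_ext ?_⟩
    rintro ⟨i⟩
    refine (coeff_diffOne _ i).trans ?_
    rw [← hp i]
    have h1 := congrArg (leftDeriv i) he
    rw [leftDeriv_sum_ι_mul, map_add, map_add, leftDeriv_sum_ι_mul, leftDeriv_mul i ha,
      leftDeriv_mul i hb] at h1
    rw [h1, map_add, map_add, hz, add_zero, map_mul, map_mul]
    rfl
  · rintro ⟨z, rfl⟩
    have hsum : ∀ r ∈ freePart k (Fin n) (s + 1), proj W r = 0 →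
        ∑ i, proj W (FreeAlgebra.ι k i) * proj W (leftDeriv i r) = 0 := by
      intro r hr hr0
      simp only [← map_mul, ← map_sum]
      rw [sum_ι_mul_leftDeriv hr, hr0]
    refine coeff_ext fun _ => ?_
    rw [map_zero]
    refine (coeff_diffZero _).trans ?_
    simp only [coeff_diffOne, mul_add, Finset.sum_add_distrib, ← mul_assoc, ← Finset.sum_mul]
    rw [hsum a ha (proj_eq_zero_of_mem (hW ▸ Submodule.subset_span (by simp))),
      hsum b hb (proj_eq_zero_of_mem (hW ▸ Submodule.subset_span (by simp))), zero_mul, zero_mul,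
      add_zero]

/-- The augmentation of the free module of rank one. -/
noncomputable def augZero {s : ℕ} (hW : W ≤ freePart k (Fin n) (s + 1)) :
    (freeZero W).carrier →ₗ[k] k :=
  (augmentation hW).toLinearMap ∘ₗ
    (Finsupp.lapply PUnit.unit : (PUnit.{u + 1} →₀ Alg W) →ₗ[k] Alg W)

theorem augZero_apply {s : ℕ} (hW : W ≤ freePart k (Fin n) (s + 1)) (x : (freeZero W).carrier) :
    augZero hW x = augmentation hW (coeff PUnit.unit x) := rfl

theorem augZero_mem {s : ℕ} (hW : W ≤ freePart k (Fin n) (s + 1)) :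
    augZero hW ∈ (freeZero W).homTrivial 0 := by
  refine ⟨fun d a p hd ha => ?_, fun l p hp hl => ?_⟩
  · rw [augZero_apply, map_smul]
    change augmentation hW (coeff PUnit.unit p * a) = 0
    rw [map_mul, augmentation_of_mem hW hd.ne' ha, mul_zero]
  · rw [augZero_apply]
    obtain h | ⟨d, hd, ha⟩ := exists_of_mem_intPart (mem_free_deg_iff_coeff.1 hp PUnit.unit)
    · exact (congrArg _ h).trans (map_zero _)
    · exact augmentation_of_mem hW (by omega) ha

theorem augZero_surjective {s : ℕ} (hW : W ≤ freePart k (Fin n) (s + 1)) :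
    Function.Surjective (augZero hW) := fun c =>
  ⟨ofCoeff fun _ => algebraMap k _ c, AlgHom.commutes (augmentation hW) c⟩

theorem exact_diffZero_augZero {s : ℕ} (hW : W ≤ freePart k (Fin n) (s + 1)) :
    Function.Exact diffZero (augZero hW) := by
  intro x
  constructor
  · intro hx
    obtain ⟨p, hp⟩ := proj_surjective (W := W) (coeff PUnit.unit x)
    obtain ⟨q, hq⟩ := exists_eq_algebraMap_add_sum p
    rw [augZero_apply, ← hp, augmentation_proj] at hx
    rw [hx, map_zero, zero_add] at hq
    refine ⟨ofCoeff fun i => proj W (q i.down), coeff_ext fun _ => ?_⟩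
    refine (coeff_diffZero _).trans (Eq.trans ?_ hp)
    rw [hq, map_sum]
    simp only [map_mul]
    rfl
  · rintro ⟨z, rfl⟩
    rw [augZero_apply, coeff_diffZero, map_sum]
    refine Finset.sum_eq_zero fun i _ => ?_
    rw [map_mul, augmentation_of_mem hW one_ne_zero (proj_mem_part (ι_mem_freePart i)), zero_mul]

/-- A graded projective resolution of the trivial module over `k⟨X⟩ / (a, b)`. -/
noncomputable def twoRelatorResolution {s : ℕ} {a b : FreeAlgebra k (Fin n)}
    (ha : a ∈ freePart k (Fin n) (s + 1)) (hb : b ∈ freePart k (Fin n) (s + 1))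
    (hW : W = Submodule.span k {a, b}) (hWs : W ≤ freePart k (Fin n) (s + 1)) :
    GrRes (part W) :=
  GrArrow.resolution ⟨freeOne W, freeTwo W (s + 1), diffOne (s + 1) a b, diffOne_mem ha hb,
    free_projective⟩ free_projective (freeZero W) free_projective diffZero diffZero_mem
    (augZero hWs) (augZero_mem hWs) (augZero_surjective hWs) (exact_diffZero_augZero hWs)
    (exact_diffOne_diffZero ha hb hW)

theorem coeff_freeTwo {s : ℕ} {l : ℤ} {x : (freeTwo W s).carrier} (hx : x ∈ (freeTwo W s).deg l)
    (t : ULift.{u} Bool) :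
    coeff t x = 0 ∨ ∃ d : ℕ, l = (s : ℤ) + d ∧ coeff t x ∈ part W d := by
  obtain h | ⟨d, hd, h⟩ := exists_of_mem_intPart (mem_free_deg_iff_coeff.1 hx t)
  · exact Or.inl h
  · exact Or.inr ⟨d, by omega, h⟩

theorem eq_zero_of_mem_freeTwo {s : ℕ} {l : ℤ} (hl : l < s) {x : (freeTwo W s).carrier}
    (hx : x ∈ (freeTwo W s).deg l) : x = 0 := by
  refine coeff_ext fun t => ?_
  obtain h | ⟨d, hd, -⟩ := coeff_freeTwo hx t
  · rw [h, map_zero]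
  · omega

theorem exists_coeff_eq_proj {s d : ℕ} {x : (freeTwo W s).carrier}
    (hx : x ∈ (freeTwo W s).deg (s + d)) (t : ULift.{u} Bool) :
    ∃ p ∈ freePart k (Fin n) d, proj W p = coeff t x := by
  obtain h | ⟨e, he, h⟩ := coeff_freeTwo hx t
  · exact ⟨0, zero_mem _, by rw [h, map_zero]⟩
  · obtain rfl : d = e := by omega
    exact mem_part_iff.1 h

/-- This is minimality at the third term. In the generating degree the kernel is zero by
independence of the relators; in higher degrees every element is a combination of the generators
with coefficients of positive degree, on which `ψ` vanishes. -/
theorem homTrivial_apply_eq_zero_of_ker {s : ℕ} {a b : FreeAlgebra k (Fin n)}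
    (ha : a ∈ freePart k (Fin n) (s + 1)) (hb : b ∈ freePart k (Fin n) (s + 1))
    (hWs : W ≤ freePart k (Fin n) (s + 1))
    (hind : ∀ α β : k, α • a + β • b = 0 → α = 0 ∧ β = 0) {l : ℤ}
    {x : (freeTwo W (s + 1)).carrier} (hx : x ∈ (freeTwo W (s + 1)).deg l)
    (hdx : diffOne (s + 1) a b x = 0) {e : ℤ} {ψ : (freeTwo W (s + 1)).carrier →ₗ[k] k}
    (hψ : ψ ∈ (freeTwo W (s + 1)).homTrivial e) : ψ x = 0 := by
  rcases lt_or_ge l ((s + 1 : ℕ) : ℤ) with hl | hl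
  · rw [eq_zero_of_mem_freeTwo hl hx, map_zero]
  obtain ⟨d, rfl⟩ : ∃ d : ℕ, l = ((s + 1 : ℕ) : ℤ) + d := ⟨(l - (s + 1 : ℕ)).toNat, by omega⟩
  rcases Nat.eq_zero_or_pos d with rfl | hd
  · obtain ⟨p, hp, hp'⟩ := exists_coeff_eq_proj hx ⟨true⟩
    obtain ⟨q, hq, hq'⟩ := exists_coeff_eq_proj hx ⟨false⟩
    have h0 : a * p + b * q = 0 := by
      refine leftDeriv_ext (add_mem (mul_mem_freePart ha hp rfl) (mul_mem_freePart hb hq rfl))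
        (zero_mem _) fun i => ?_
      rw [map_zero]
      have h1 := coeff_diffOne (a := a) (b := b) x i
      rw [hdx, ← hp', ← hq', ← map_mul, ← map_mul, ← map_add, map_zero] at h1
      rw [map_add, leftDeriv_mul i ha, leftDeriv_mul i hb]
      exact eq_zero_of_proj_eq_zero hWs (Nat.lt_succ_self s)
        (add_mem (mul_mem_freePart (leftDeriv_mem i ha) hp rfl)
          (mul_mem_freePart (leftDeriv_mem i hb) hq rfl)) h1.symm
    obtain ⟨rfl, rfl⟩ := eq_zero_of_mul_add_mul_eq_zero ha hb hind h0
    have : x = 0 := by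
      refine coeff_ext ?_
      rintro ⟨_ | _⟩
      · exact hq'.symm.trans ((map_zero _).trans (map_zero _).symm)
      · exact hp'.symm.trans ((map_zero _).trans (map_zero _).symm)
    rw [this, map_zero]
  · rw [eq_sum_smul x, map_sum]
    refine Finset.sum_eq_zero fun t _ => ?_
    obtain ⟨p, hp, hp'⟩ := exists_coeff_eq_proj hx t
    exact hψ.1 d _ _ hd (hp' ▸ proj_mem_part hp)

/-- The kernel element `(0, f)`, of degree `2s - 1`, cannot be generated by the kernel in degree `s
+ 1`, where the second coefficient always vanishes. -/
theorem not_isSKoszul {N : ℕ} {y f : FreeAlgebra k (Fin n)} (hy : y ∈ freePart k (Fin n) 1)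
    (hf : f ∈ freePart k (Fin n) (N + 2))
    (hind : ∀ α β : k, α • (y * f) + β • (f * y) = 0 → α = 0 ∧ β = 0)
    (hsyz : ∀ a ∈ freePart k (Fin n) 1, ∀ b ∈ freePart k (Fin n) 1, ∀ c ∈ freePart k (Fin n) 1,
      ∀ d ∈ freePart k (Fin n) 1,
        y * f * a + f * y * b = c * (y * f) + d * (f * y) → b = 0)
    (hW : W = Submodule.span k {y * f, f * y}) (hWs : W ≤ freePart k (Fin n) (N + 2 + 1)) :
    ¬ IsSKoszul (N + 3) W := by
  intro hK
  have hyf : y * f ∈ freePart k (Fin n) (N + 2 + 1) := mul_mem_freePart hy hf (by ring)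
  have hfy : f * y ∈ freePart k (Fin n) (N + 2 + 1) := mul_mem_freePart hf hy rfl
  have hyf0 : proj W (y * f) = 0 :=
    proj_eq_zero_of_mem (hW ▸ Submodule.subset_span (by simp))
  let R : GrRes (part W) := twoRelatorResolution hyf hfy hW hWs
  -- For `s = N + 3` one has `χ_s(3) = s + 1`.
  have hext : ∀ e : ℤ, e ≠ -((N + 3 + 1 : ℕ) : ℤ) → R.ExtPartIsZero (1 + 2) e := by
    intro e he
    refine hK R 3 e ?_
    convert he using 3
    simp [chi, Nat.even_iff]
  have hgen : ∀ (l : ℤ) (x : (freeTwo W (N + 2 + 1)).carrier),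
      x ∈ (freeTwo W (N + 2 + 1)).deg l → diffOne (N + 2 + 1) (y * f) (f * y) x = 0 →
      x ∈ Submodule.span (Alg W)ᵐᵒᵖ {z : (freeTwo W (N + 2 + 1)).carrier |
        z ∈ (freeTwo W (N + 2 + 1)).deg ((N + 3 + 1 : ℕ) : ℤ) ∧
          diffOne (N + 2 + 1) (y * f) (f * y) z = 0} := fun l x hx hdx =>
    R.mem_span_of_extPartIsZero (i := 1) (b := ((N + 2 + 1 : ℕ) : ℤ))
      (fun _ hl _ hx => eq_zero_of_mem_freeTwo hl hx)
      (fun _ _ hx hdx _ hψ => homTrivial_apply_eq_zero_of_ker hyf hfy hWs hind hx hdx hψ)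
      hext hx hdx
  -- The index `false` belongs to the generator that maps to the relator `f y`.
  have hle : Submodule.span (Alg W)ᵐᵒᵖ {z : (freeTwo W (N + 2 + 1)).carrier |
        z ∈ (freeTwo W (N + 2 + 1)).deg ((N + 3 + 1 : ℕ) : ℤ) ∧
          diffOne (N + 2 + 1) (y * f) (f * y) z = 0} ≤
      LinearMap.ker (coeff (𝒜 := part W) (δ := fun _ => ((N + 2 + 1 : ℕ) : ℤ))
        (ULift.up.{u} false)) := by
    rw [Submodule.span_le]
    rintro z ⟨hz, hdz⟩
    rw [Nat.cast_add _ 1] at hz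
    obtain ⟨p, hp, hp'⟩ := exists_coeff_eq_proj (d := 1) hz ⟨true⟩
    obtain ⟨q, hq, hq'⟩ := exists_coeff_eq_proj (d := 1) hz ⟨false⟩
    have h1 : ∀ i, leftDeriv i (y * f) * p + leftDeriv i (f * y) * q ∈ W := fun i => by
      refine mem_of_proj_eq_zero hWs
        (add_mem (mul_mem_freePart (leftDeriv_mem i hyf) hp rfl)
          (mul_mem_freePart (leftDeriv_mem i hfy) hq rfl)) ?_
      rw [map_add, map_mul (proj W), map_mul (proj W), hp', hq', ← coeff_diffOne, hdz, map_zero]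
    simp only [hW, Submodule.mem_span_pair] at h1
    -- In degree `s` the ideal is just `W`, so each component is a scalar combination of the
    -- relators. Multiplying by `xᵢ` on the left and summing assembles these scalars into linear
    -- forms `c`, `d` and gives a linear syzygy.
    choose c d hcd using h1
    have hq0 : q = 0 := by
      refine hsyz p hp q hq (∑ i, c i • FreeAlgebra.ι k i)
        (sum_mem fun i _ => Submodule.smul_mem _ _ (ι_mem_freePart i))
        (∑ i, d i • FreeAlgebra.ι k i)
        (sum_mem fun i _ => Submodule.smul_mem _ _ (ι_mem_freePart i)) ?_
      conv_lhs => rw [← sum_ι_mul_leftDeriv hyf, ← sum_ι_mul_leftDeriv hfy]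
      simp only [Finset.sum_mul, ← Finset.sum_add_distrib, mul_assoc, ← mul_add]
      refine Finset.sum_congr rfl fun i _ => ?_
      rw [← hcd i]
      simp only [mul_add, mul_smul_comm, smul_mul_assoc]
    exact hq'.symm.trans (by rw [hq0, map_zero])
  let x₀ : (freeTwo W (N + 2 + 1)).carrier := ofCoeff fun t => bif t.down then 0 else proj W f
  have hx₀ : x₀ ∈ (freeTwo W (N + 2 + 1)).deg ((N + 2 + 1 : ℕ) + (N + 2 : ℕ)) := by
    refine mem_free_deg_iff_coeff.2 ?_
    rintro ⟨_ | _⟩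
    · rw [add_sub_cancel_left, intPart_natCast]
      exact proj_mem_part hf
    · exact zero_mem _
  -- Each component is `∂ᵢ(f y) f = ∂ᵢf · (y f)`, which is zero in `Λ`.
  have hdx₀ : diffOne (N + 2 + 1) (y * f) (f * y) x₀ = 0 := by
    refine coeff_ext ?_
    rintro ⟨i⟩
    refine (coeff_diffOne x₀ i).trans ?_
    change _ * 0 + _ * proj W f = _
    rw [map_zero, mul_zero, zero_add, leftDeriv_mul i hf, ← map_mul, mul_assoc, map_mul, hyf0,
      mul_zero]
  have hf0 : proj W f = 0 := hle (hgen _ x₀ hx₀ hdx₀)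
  have := eq_zero_of_proj_eq_zero hWs (Nat.lt_succ_self _) hf hf0
  exact one_ne_zero (hind 1 0 (by simp [this])).1

end Resolution

end HomogeneousAlgebra

/-! ### The proposition for an arbitrary presentation. -/

theorem mainTheorem10 {k : Type*} [Field k] [IsAlgClosed k] (s : ℕ) (hs : 2 < s)
    (m : ℕ) (f y : FreeAlgebra k (Fin m ⊕ Unit))
    (hy : y = FreeAlgebra.ι k (Sum.inr ()))
    (hf : f ∈ HomogeneousAlgebra.freePart k (Fin m ⊕ Unit) (s - 1))
    (hlin : LinearIndependent k ![y * f, f * y])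
    (n : ℕ) (W : Submodule k (FreeAlgebra k (Fin n)))
    (hW : W ≤ HomogeneousAlgebra.freePart k (Fin n) s)
    (e : HomogeneousAlgebra.Alg W ≃ₐ[k]
      HomogeneousAlgebra.Alg (Submodule.span k {y * f, f * y}))
    (he : ∀ d : ℕ, (HomogeneousAlgebra.part W d).map e.toLinearMap =
      HomogeneousAlgebra.part (Submodule.span k {y * f, f * y}) d)
    (hexc : ¬ ∃ (t : ℕ) (g : FreeAlgebra k (Fin m ⊕ Unit)), s = 2 * t ∧
      g ∈ HomogeneousAlgebra.freePart k (Fin m ⊕ Unit) 1 ∧ f = (g * y) ^ (t - 1) * g) :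
    ¬ HomogeneousAlgebra.ExtraCondition s W ∧ ¬ HomogeneousAlgebra.IsSKoszul s W := by
  open HomogeneousAlgebra in
  obtain ⟨N, rfl⟩ : ∃ N, s = N + 3 := ⟨s - 3, by omega⟩
  replace hf : f ∈ freePart k (Fin m ⊕ Unit) (N + 2) := hf
  have hy1 : y ∈ freePart k (Fin m ⊕ Unit) 1 := hy ▸ ι_mem_freePart _
  have hind : ∀ α β : k, α • (y * f) + β • (f * y) = 0 → α = 0 ∧ β = 0 :=
    LinearIndependent.pair_iff.1 hlin
  have hW' : Submodule.span k {y * f, f * y} ≤ freePart k (Fin m ⊕ Unit) (N + 3) := by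
    rw [Submodule.span_le]
    rintro _ (rfl | rfl)
    exacts [mul_mem_freePart hy1 hf (by ring), mul_mem_freePart hf hy1 rfl]
  obtain ⟨Φ, hΦ, hΦ', hΦW⟩ := exists_algEquiv_of_algEquiv (by omega) hW hW' e (he 1)
  have hWΦ : W = Submodule.span k {Φ y * Φ f, Φ f * Φ y} := by
    rw [← hΦW, Submodule.map_span, Set.image_pair]
    simp
  have hΦy : Φ y ∈ freePart k (Fin n) 1 := map_freePart_mem Φ.toAlgHom hΦ hy1
  have hΦf : Φ f ∈ freePart k (Fin n) (N + 2) := map_freePart_mem Φ.toAlgHom hΦ hf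
  have hΦind : ∀ α β : k, α • (Φ y * Φ f) + β • (Φ f * Φ y) = 0 → α = 0 ∧ β = 0 := by
    intro α β h
    refine hind α β (Φ.injective ?_)
    simpa using h
  have hsymm : ∀ x ∈ freePart k (Fin n) 1, Φ.symm x ∈ freePart k (Fin m ⊕ Unit) 1 :=
    fun x hx => map_freePart_mem Φ.symm.toAlgHom hΦ' hx
  -- In the generators of `W` the form `Φ y` need not be a letter, so syzygies are pulled back along
  -- `Φ` to where it is one.
  have hsyz : ∀ a ∈ freePart k (Fin n) 1, ∀ b ∈ freePart k (Fin n) 1,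
      ∀ c ∈ freePart k (Fin n) 1, ∀ d ∈ freePart k (Fin n) 1,
      Φ y * Φ f * a + Φ f * Φ y * b = c * (Φ y * Φ f) + d * (Φ f * Φ y) → b = 0 := by
    intro a _ b hb c hc d hd h
    subst hy
    refine Φ.symm.injective ((eq_zero_of_linear_syzygy (a := Φ.symm a) hf (hsymm b hb)
      (hsymm c hc) (hsymm d hd) hind hexc ?_).trans (map_zero _).symm)
    simpa using congrArg Φ.symm h
  let _ : GradedAlgebra (part W) := (part_isInternal hW).gradedAlgebra
  refine ⟨?_, not_isSKoszul hΦy hΦf hΦind hsyz hWΦ hW⟩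
  rw [hWΦ]
  exact not_extraCondition hΦy hΦf hΦind hsyz
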